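/- Graphs are finite and undirected, and may have multiple edges. A 2-terminal graph $(G,s,t)$ is a graph $G$ with two distinguished vertices $s\neq t$. Given 2-terminal graphs $(G_1,s_1,t_1)$ and $(G_2,s_2,t_2)$ on disjoint vertex sets, their parallel composition is obtained from $G_1\cup G_2$ by identifying $s_2$ with $s_1$ and $t_2$ with $t_1$ (terminals $s_1,t_1$), and their series composition by identifying $t_1$ with $s_2$ (terminals $s_1,t_2$). The Wheatstone bridge is the 2-terminal graph $(W,s,t)$ in which $W$ is $K_4$ minus an edge and $s,t$ are its two vertices of degree $2$. Let $\mathcal{W}$ be the smallest class of 2-terminal graphs (up to isomorphism) that contains $K_2$ (with its two vertices as terminals) and the Wheatstone bridge and is closed under series and parallel composition. The maxmaxflow of $G$ is $$\Lambda(G)=\max_{x\neq y}\lambda_G(x,y),$$ where $\lambda_G(x,y)$ is the maximum number of edge-disjoint paths in $G$ from $x$ to $y$. The chromatic polynomial of $G=(V,E)$ is $P_G(q)=\sum_{A\subseteq E}(-1)^{|A|}q^{k(A)}$, where $k(A)$ is the number of connected components of $(V,A)$. **Corollary 8.4.** Fix an integer $\Lambda\ge 3$. The equation $$(1+\rho)^{\Lambda+1}=4\,(1-\rho+2\rho^2)^{\Lambda-1}$$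 has a unique solution $\rho=\rho^{\star\star}_\Lambda$ in the interval $(0,1)$. If $(G,s,t)$ is a 2-terminal graph in $\mathcal{W}$ such that $G$ has maxmaxflow at most $\Lambda$, then $P_G(q)\neq 0$ for every complex number $q$ with $$|q-1|\ \ge\ 1/\rho^{\star\star}_\Lambda .$$ -/

import Mathlib

open scoped Polynomial

namespace Graph

/-!
Graphs are Mathlib's multigraphs `Graph α β` (parallel edges and loops allowed), with vertices in
`α` and edges in `β`. A 2-terminal graph `(G, s, t)` is given by `G` and its terminals `s`, `t`.
-/

/-! ### Paths, maximum flow and maxmaxflow -/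

/-- `G.IsWalk x y vs es`: there is a walk in `G` from `x` to `y` whose successive vertices are the
members of the list `vs` and whose successive edges are the members of the list `es`. -/
inductive IsWalk {α β : Type*} (G : Graph α β) : α → α → List α → List β → Prop
  | nil (x : α) (hx : x ∈ V(G)) : IsWalk G x x [x] []
  | cons (e : β) (x y z : α) (vs : List α) (es : List β)
      (he : G.IsLink e x y) (hw : IsWalk G y z vs es) : IsWalk G x z (x :: vs) (e :: es)

/-- `es` is the list of edges of a path (no repeated vertex) in `G` from `x` to `y`. -/
def IsPath {α β : Type*} (G : Graph α β) (x y : α) (es : List β) : Prop :=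
  ∃ vs : List α, G.IsWalk x y vs es ∧ vs.Nodup

/-- There are `k` pairwise edge-disjoint paths in `G` from `x` to `y`. -/
def HasEdgeDisjointPaths {α β : Type*} (G : Graph α β) (x y : α) (k : ℕ) : Prop :=
  ∃ P : Fin k → List β,
    (∀ i, G.IsPath x y (P i)) ∧ ∀ i j, i ≠ j → (P i).Disjoint (P j)

/-- The maximum flow between `x` and `y`: the maximum number of edge-disjoint paths in `G` from
`x` to `y` (meaningful for `x ≠ y`). -/
noncomputable def maxFlow {α β : Type*} (G : Graph α β) (x y : α) : ℕ∞ :=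
  ⨆ (k : ℕ) (_ : G.HasEdgeDisjointPaths x y k), (k : ℕ∞)

/-- The maxmaxflow of `G`: the maximum of the maximum flows between two distinct vertices. -/
noncomputable def maxmaxflow {α β : Type*} (G : Graph α β) : ℕ∞ :=
  ⨆ (x : α) (_ : x ∈ V(G)) (y : α) (_ : y ∈ V(G)) (_ : x ≠ y), G.maxFlow x y

/-! ### The chromatic polynomial -/

/-- The number `k(A)` of connected components of the subgraph `(V(G), A)`: the number of classes
of the equivalence relation on `V(G)` generated by the edges in `A`. -/
noncomputable def numComponents {α β : Type*} (G : Graph α β) (A : Set β) : ℕ :=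
  Nat.card (Quot fun x y : V(G) => ∃ e ∈ A, G.IsLink e x y)

/-- The multivariate Tutte polynomial `Z_G(q, v) = ∑_{A ⊆ E} q ^ k(A) ∏_{e ∈ A} v_e` of a finite
graph, over an arbitrary commutative ring. -/
noncomputable def multivariateTutte {α β R : Type*} [CommRing R]
    (G : Graph α β) (q : R) (v : β → R) : R :=
  ∑ᶠ A ∈ 𝒫 E(G), q ^ G.numComponents A * ∏ᶠ e ∈ A, v e

/-- The chromatic polynomial `P_G(q) = Z_G(q, -1)` of a finite graph, an element of `ℤ[q]`. -/
noncomputable def chromaticPolynomial {α β : Type*} (G : Graph α β) : ℤ[X] :=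
  G.multivariateTutte Polynomial.X fun _ => -1

/-! ### 2-terminal graphs and the Wheatstone class -/

/-- `G` is the union of `G₁` and `G₂`, which have no edge in common. -/
structure IsEdgeDisjointUnion {α β : Type*} (G G₁ G₂ : Graph α β) : Prop where
  vertexSet_eq : V(G) = V(G₁) ∪ V(G₂)
  isLink_iff : ∀ e x y, G.IsLink e x y ↔ G₁.IsLink e x y ∨ G₂.IsLink e x y
  disjoint_edgeSet : Disjoint E(G₁) E(G₂)

/-- `(G, s, t)` is the parallel composition of `(G₁, s, t)` and `(G₂, s, t)`: the terminals with
the same name have been identified, and `G₁` and `G₂` share nothing else. -/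
structure IsParallelComposition {α β : Type*} (G G₁ G₂ : Graph α β) (s t : α) : Prop
    extends G.IsEdgeDisjointUnion G₁ G₂ where
  inter_eq : V(G₁) ∩ V(G₂) = {s, t}

/-- `(G, s, t)` is the series composition of `(G₁, s, m)` and `(G₂, m, t)`: the second terminal of
`G₁` has been identified with the first terminal of `G₂` (to give `m`), and `G₁` and `G₂` share
nothing else. -/
structure IsSeriesComposition {α β : Type*} (G G₁ G₂ : Graph α β) (m : α) : Prop
    extends G.IsEdgeDisjointUnion G₁ G₂ where
  inter_eq : V(G₁) ∩ V(G₂) = {m}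

/-- `(G, s, t)` is a complete graph `K₂` with its two vertices as terminals. -/
structure IsK2 {α β : Type*} (G : Graph α β) (s t : α) : Prop where
  ne : s ≠ t
  exists_eq : ∃ e : β, G = Graph.banana s t {e}

/-- `(G, s, t)` is a Wheatstone bridge: `G` is `K₄` minus an edge, and `s`, `t` are its two
vertices of degree 2, i.e. `G` has the four vertices `s`, `a`, `b`, `t` and the five edges
`sa`, `sb`, `ab`, `at`, `bt`. -/
def IsWheatstoneBridge {α β : Type*} (G : Graph α β) (s t : α) : Prop :=
  ∃ (a b : α) (e₁ e₂ e₃ e₄ e₅ : β),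
    [s, a, b, t].Nodup ∧ [e₁, e₂, e₃, e₄, e₅].Nodup ∧
    V(G) = {s, a, b, t} ∧ E(G) = {e₁, e₂, e₃, e₄, e₅} ∧
    G.IsLink e₁ s a ∧ G.IsLink e₂ s b ∧ G.IsLink e₃ a b ∧ G.IsLink e₄ a t ∧ G.IsLink e₅ b t

/-- The smallest class of 2-terminal graphs `(G, s, t)` that contains `K₂` and the Wheatstone
bridge (and everything isomorphic to them) and is closed under series and parallel composition.
The terminals of a member of the class are distinct, and the member is finite. -/
inductive InWheatstoneClass {α β : Type*} : Graph α β → α → α → Prop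
  | k2 (G : Graph α β) (s t : α) (h : G.IsK2 s t) : InWheatstoneClass G s t
  | bridge (G : Graph α β) (s t : α) (h : G.IsWheatstoneBridge s t) : InWheatstoneClass G s t
  | parallel (G G₁ G₂ : Graph α β) (s t : α)
      (h₁ : InWheatstoneClass G₁ s t) (h₂ : InWheatstoneClass G₂ s t)
      (h : G.IsParallelComposition G₁ G₂ s t) : InWheatstoneClass G s t
  | series (G G₁ G₂ : Graph α β) (s m t : α)
      (h₁ : InWheatstoneClass G₁ s m) (h₂ : InWheatstoneClass G₂ m t)
      (h : G.IsSeriesComposition G₁ G₂ m) : InWheatstoneClass G s t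

end Graph

/-! Put Q = |q - 1|. For a 2-terminal graph let S and D be the polynomials that count proper
colourings whose terminals have prescribed equal, respectively different, colours. Then P_G = q * T
with T = S + (q - 1) * D (`CountsColorings.chromaticPolynomial_eq`), so everything rests on
controlling the transmissivity t = (S - D) / T. In series T and t multiply; in parallel S and D
multiply.

To a bound |t| ≤ r attach the number (1 + Q r) / (1 + r), which increases with r and is
multiplicative under the worst-case parallel law, that of q = 1 - Q and t = -r. The invariant is
that this number is at most y ^ k, where the terminals are joined by k edge-disjoint walks. As long
as y ^ k ≤ 2Q / (1 + Q), it forces |t| ≤ 1/Q, and two such graphs in parallel have T ≠ 0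
(`InRegion.parallel`), while in series they give |t| ≤ 1/Q² (`InRegion.series`). A single edge has
|t| = 1/Q exactly; it is treated apart, by S = 0, a condition that parallel composition preserves.
The bridge has two disjoint paths and dictates y² = Q(Q + 1) / (Q² - Q + 2); this y also covers
series compositions.

The flow bound enters through detours: if the terminals of a piece are also joined by a walk outside
it, then k + 1 walks are disjoint and k ≤ Λ - 1. In a parallel composition each half is a detour for
the other; inside a series composition an outer detour is completed through the other half
(`InWheatstoneClass.exists_inRegion`). Hence all that is needed is y ^ (Λ - 1) ≤ 2Q / (1 + Q),
which, squared and written with ρ = 1/Q, is the equation for the radius with ≤ in place of =. -/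

/-! ### The equation for the radius -/

namespace WheatstoneRadius

open Real Set

/-- The difference of the logarithms of the two sides of the equation for the radius. -/
noncomputable def logGap (n : ℕ) (x : ℝ) : ℝ :=
  (n + 1) * log (1 + x) - (n - 1) * log (1 - x + 2 * x ^ 2) - log 4

/-- The numerator of the derivative of `logGap`. -/
noncomputable def gapNum (n : ℕ) (x : ℝ) : ℝ :=
  2 * n + (2 - 4 * n) * x + (6 - 2 * n) * x ^ 2

theorem quad_pos (x : ℝ) : 0 < 1 - x + 2 * x ^ 2 := by nlinarith [sq_nonneg (x - 1 / 4)]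

theorem hasDerivAt_logGap (n : ℕ) {x : ℝ} (hx : 0 ≤ x) :
    HasDerivAt (logGap n) (gapNum n x / ((1 + x) * (1 - x + 2 * x ^ 2))) x := by
  have h1 : HasDerivAt (fun x : ℝ => 1 + x) 1 x := by
    simpa using (hasDerivAt_id x).const_add 1
  have h2 : HasDerivAt (fun x : ℝ => 1 - x + 2 * x ^ 2) (-1 + 2 * (2 * x)) x := by
    simpa using ((hasDerivAt_id x).const_sub 1).fun_add (((hasDerivAt_id x).pow 2).const_mul 2)
  have hq := quad_pos x
  have h1x : (0 : ℝ) < 1 + x := by linarith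
  refine ((((h1.log h1x.ne').const_mul ((n : ℝ) + 1)).fun_sub
    ((h2.log hq.ne').const_mul ((n : ℝ) - 1))).sub_const (log 4)).congr_deriv ?_
  unfold gapNum
  generalize hd : 1 - x + 2 * x ^ 2 = d at hq ⊢
  field_simp
  rw [← hd]
  ring

/-- For n ≥ 3 the coefficient of x is negative and that of x² is at most 0. Hence `logGap` has at
most one critical point on the nonnegative axis. -/
theorem gapNum_strictAnti {n : ℕ} (hn : 3 ≤ n) {x y : ℝ} (hx : 0 ≤ x) (hxy : x < y) :
    gapNum n y < gapNum n x := by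
  have hn' : (3 : ℝ) ≤ n := by exact_mod_cast hn
  unfold gapNum
  nlinarith [mul_nonneg (sub_nonneg.2 hn') (mul_nonneg (sub_pos.2 hxy).le (by linarith : 0 ≤ x + y)),
    mul_nonneg (sub_nonneg.2 hn') (sub_pos.2 hxy).le]

theorem logGap_zero (n : ℕ) : logGap n 0 = - log 4 := by simp [logGap]

/-- The endpoint 1 is always a root of the equation, both sides being 2 ^ (n + 1) for n ≥ 1; it
supplies an extra zero for Rolle's theorem. -/
theorem logGap_one (n : ℕ) : logGap n 1 = 0 := by
  have : log 4 = 2 * log 2 := by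
    rw [show (4 : ℝ) = 2 ^ 2 by norm_num, log_pow]; norm_num
  unfold logGap
  norm_num
  rw [this]; ring

theorem logGap_continuousOn (n : ℕ) : ContinuousOn (logGap n) (Icc 0 1) := fun _ hx =>
  (hasDerivAt_logGap n hx.1).continuousAt.continuousWithinAt

/-- Rolle's theorem for `logGap`. -/
theorem exists_gapNum_eq_zero (n : ℕ) {a b : ℝ} (ha : 0 ≤ a) (hab : a < b) (hb : b ≤ 1)
    (h : logGap n a = logGap n b) : ∃ c ∈ Ioo a b, gapNum n c = 0 := by
  obtain ⟨c, hc, h0⟩ := exists_hasDerivAt_eq_zero hab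
    ((logGap_continuousOn n).mono (Icc_subset_Icc ha hb)) h
    (fun x hx => hasDerivAt_logGap n (ha.trans hx.1.le))
  refine ⟨c, hc, ?_⟩
  have hq := quad_pos c
  have h1x : (0 : ℝ) < 1 + c := by linarith [hc.1]
  rcases div_eq_zero_iff.1 h0 with h0 | h0
  · exact h0
  · exact absurd h0 (mul_pos h1x hq).ne'

/-- Two zeros a < b, together with the zero at 1, would give two critical points. -/
theorem logGap_unique {n : ℕ} (hn : 3 ≤ n) {a b : ℝ} (ha : a ∈ Ioo (0 : ℝ) 1)
    (hb : b ∈ Ioo (0 : ℝ) 1) (h0a : logGap n a = 0) (h0b : logGap n b = 0) : a = b := by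
  have key : ∀ a b : ℝ, a ∈ Ioo (0 : ℝ) 1 → b ∈ Ioo (0 : ℝ) 1 → logGap n a = 0 →
      logGap n b = 0 → ¬ a < b := by
    intro a b ha hb h0a h0b hab
    obtain ⟨c, hc, hc0⟩ := exists_gapNum_eq_zero n ha.1.le hab hb.2.le (h0a.trans h0b.symm)
    obtain ⟨d, hd, hd0⟩ := exists_gapNum_eq_zero n hb.1.le hb.2 le_rfl
      (h0b.trans (logGap_one n).symm)
    have := gapNum_strictAnti hn (ha.1.trans hc.1).le (hc.2.trans hd.1)
    linarith
  exact le_antisymm (not_lt.1 (key b a hb ha h0b h0a)) (not_lt.1 (key a b ha hb h0a h0b))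

/-- The point 7/8 is close enough to 1 for `gapNum` to be negative from there on, for every n ≥ 3;
so `logGap` decreases to its value 0 at 1. -/
theorem logGap_pos {n : ℕ} (hn : 3 ≤ n) : 0 < logGap n (7 / 8) := by
  have hn' : (3 : ℝ) ≤ n := by exact_mod_cast hn
  obtain ⟨c, hc, h⟩ := exists_hasDerivAt_eq_slope (logGap n) _ (by norm_num : (7 / 8 : ℝ) < 1)
    ((logGap_continuousOn n).mono (Icc_subset_Icc (by norm_num) le_rfl))
    (fun x hx => hasDerivAt_logGap n (le_trans (by norm_num) hx.1.le))
  have h1 : gapNum n c < 0 := by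
    refine (gapNum_strictAnti hn (by norm_num) hc.1).trans ?_
    unfold gapNum
    nlinarith
  have hq := quad_pos c
  have h1x : (0 : ℝ) < 1 + c := by linarith [hc.1]
  have h2 : gapNum n c / ((1 + c) * (1 - c + 2 * c ^ 2)) < 0 :=
    div_neg_of_neg_of_pos h1 (mul_pos h1x hq)
  rw [h, logGap_one] at h2
  norm_num at h2
  linarith

theorem logGap_eq_log_sub_log {n : ℕ} (hn : 1 ≤ n) (x : ℝ) :
    logGap n x = log ((1 + x) ^ (n + 1)) - log (4 * (1 - x + 2 * x ^ 2) ^ (n - 1)) := by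
  have hq := quad_pos x
  rw [log_mul (by norm_num) (pow_pos hq _).ne', log_pow, log_pow, Nat.cast_sub hn]
  unfold logGap
  push_cast
  ring

theorem logGap_eq_zero_iff {n : ℕ} (hn : 1 ≤ n) {x : ℝ} (hx : 0 ≤ x) :
    logGap n x = 0 ↔ (1 + x) ^ (n + 1) = 4 * (1 - x + 2 * x ^ 2) ^ (n - 1) := by
  have hq := quad_pos x
  rw [logGap_eq_log_sub_log hn x, sub_eq_zero]
  exact log_injOn_pos.eq_iff (by simp only [mem_Ioi]; positivity)
    (by simp only [mem_Ioi]; exact mul_pos (by norm_num) (pow_pos hq _))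

theorem logGap_nonpos_iff {n : ℕ} (hn : 1 ≤ n) {x : ℝ} (hx : 0 ≤ x) :
    logGap n x ≤ 0 ↔ (1 + x) ^ (n + 1) ≤ 4 * (1 - x + 2 * x ^ 2) ^ (n - 1) := by
  have hq := quad_pos x
  rw [logGap_eq_log_sub_log hn x, sub_nonpos]
  exact log_le_log_iff (by positivity) (mul_pos (by norm_num) (pow_pos hq _))

/-- The equation for the radius has a unique solution in `(0, 1)`, and to the left of it the
left-hand side is at most the right-hand side. -/
theorem exists_radius {n : ℕ} (hn : 3 ≤ n) : ∃ ρ ∈ Ioo (0 : ℝ) 1,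
    (1 + ρ) ^ (n + 1) = 4 * (1 - ρ + 2 * ρ ^ 2) ^ (n - 1) ∧
    (∀ x ∈ Ioo (0 : ℝ) 1, (1 + x) ^ (n + 1) = 4 * (1 - x + 2 * x ^ 2) ^ (n - 1) → x = ρ) ∧
    ∀ x, 0 ≤ x → x ≤ ρ → (1 + x) ^ (n + 1) ≤ 4 * (1 - x + 2 * x ^ 2) ^ (n - 1) := by
  have hn1 : 1 ≤ n := by omega
  have h0 : logGap n 0 < 0 := by
    rw [logGap_zero, neg_lt_zero]
    exact log_pos (by norm_num)
  have ivt : ∀ x : ℝ, 0 ≤ x → x ≤ 1 → 0 < logGap n x → ∃ ρ ∈ Ioo 0 x, logGap n ρ = 0 :=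
    fun x hx hx1 hpos => by
      exact intermediate_value_Ioo hx
        ((logGap_continuousOn n).mono (Icc_subset_Icc le_rfl hx1)) ⟨h0, hpos⟩
  obtain ⟨ρ, hρ, hρ0⟩ := ivt (7 / 8) (by norm_num) (by norm_num) (logGap_pos hn)
  have hρ1 : ρ ∈ Ioo (0 : ℝ) 1 := ⟨hρ.1, hρ.2.trans (by norm_num)⟩
  refine ⟨ρ, hρ1, (logGap_eq_zero_iff hn1 hρ.1.le).1 hρ0, fun x hx h =>
    logGap_unique hn hx hρ1 ((logGap_eq_zero_iff hn1 hx.1.le).2 h) hρ0, fun x hx hxρ => ?_⟩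
  rw [← logGap_nonpos_iff hn1 hx]
  -- A positive value at x would produce a zero in (0, x), hence a zero different from ρ.
  by_contra! hpos
  obtain ⟨c, hc, hc0⟩ := ivt x hx (hxρ.trans hρ1.2.le) hpos
  have := logGap_unique hn ⟨hc.1, hc.2.trans_le (hxρ.trans hρ1.2.le)⟩ hρ1 hc0 hρ0
  linarith [hc.2]

end WheatstoneRadius

/-! ### Regions for the transmissivity of a 2-terminal graph -/

namespace Transmissivity

/-- For a 2-terminal graph with `S`, respectively `D`, proper colourings extending given equal,
respectively different, colours of the terminals, the transmissivity
`(S - D) / (S + (q - 1) * D)` is that of a single edge (when `S = 0`), or it is bounded by some `r`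
with `(1 + |q - 1| * r) / (1 + r) ≤ y ^ k`, a quantity multiplicative under parallel
composition. -/
def InRegion (q : ℂ) (y : ℝ) (k : ℕ) (S D : ℂ) : Prop :=
  S + (q - 1) * D ≠ 0 ∧ (S = 0 ∨ ∃ r : ℝ, 0 ≤ r ∧ ‖S - D‖ ≤ r * ‖S + (q - 1) * D‖ ∧
    1 + ‖q - 1‖ * r ≤ y ^ k * (1 + r))

/-- The base `y` is compatible with series compositions and with the Wheatstone bridge. -/
structure IsGrowth (Q y : ℝ) : Prop where
  one_lt : 1 < Q
  one_le : 1 ≤ y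
  le_mul : Q * (Q + 1) ≤ y * (Q ^ 2 + 1)
  sq_mul_eq : y ^ 2 * (Q ^ 2 - Q + 2) = Q * (Q + 1)

variable {q : ℂ} {y : ℝ} {k l : ℕ} {S D S₁ D₁ S₂ D₂ : ℂ}

/-- The increasing function (1 + Q r) / (1 + r) takes the value 2Q / (1 + Q) at r = 1/Q. -/
theorem mul_le_one_of_le {Q r z : ℝ} (hQ : 1 < Q) (hr : 0 ≤ r) (hz : z * (1 + Q) ≤ 2 * Q)
    (h : 1 + Q * r ≤ z * (1 + r)) : Q * r ≤ 1 := by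
  have h1 : (1 + Q * r) * (1 + Q) ≤ 2 * Q * (1 + r) := by
    calc (1 + Q * r) * (1 + Q) ≤ z * (1 + r) * (1 + Q) := by gcongr
      _ = z * (1 + Q) * (1 + r) := by ring
      _ ≤ _ := by gcongr
  have h2 : (Q * r) * (Q - 1) ≤ 1 * (Q - 1) := by nlinarith
  exact le_of_mul_le_mul_right h2 (by linarith)

/-- Both alternatives of the region lie in the disc |t| ≤ 1/Q, the single edge on its boundary. -/
theorem InRegion.mul_norm_le (h : InRegion q y k S D) (hq : 1 < ‖q - 1‖)
    (hk : y ^ k * (1 + ‖q - 1‖) ≤ 2 * ‖q - 1‖) :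
    ‖q - 1‖ * ‖S - D‖ ≤ ‖S + (q - 1) * D‖ := by
  obtain ⟨-, rfl | ⟨r, hr, hb, hr'⟩⟩ := h
  · simp
  · calc ‖q - 1‖ * ‖S - D‖ ≤ ‖q - 1‖ * (r * ‖S + (q - 1) * D‖) := by gcongr
      _ = (‖q - 1‖ * r) * ‖S + (q - 1) * D‖ := by ring
      _ ≤ 1 * ‖S + (q - 1) * D‖ := by gcongr; exact mul_le_one_of_le hq hr hk hr'
      _ = _ := one_mul _

theorem InRegion.mono (h : InRegion q y k S D) (hy : 1 ≤ y) (hkl : k ≤ l) :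
    InRegion q y l S D := by
  obtain ⟨h0, h | ⟨r, hr, hb, hr'⟩⟩ := h
  · exact ⟨h0, .inl h⟩
  · refine ⟨h0, .inr ⟨r, hr, hb, hr'.trans ?_⟩⟩
    gcongr

theorem series_total (q S₁ D₁ S₂ D₂ : ℂ) :
    (S₁ * S₂ + (q - 1) * (D₁ * D₂)) + (q - 1) * (S₁ * D₂ + D₁ * S₂ + (q - 2) * (D₁ * D₂)) =
      (S₁ + (q - 1) * D₁) * (S₂ + (q - 1) * D₂) := by ring

/-- Transmissivities multiply, so two of modulus at most 1/Q give r = 1/Q², where (1 + Q r) / (1 +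
r) = Q(Q + 1) / (Q² + 1) ≤ y. The exponent 1 is reached whatever k and l are. -/
theorem InRegion.series (hg : IsGrowth ‖q - 1‖ y) (hk : y ^ k * (1 + ‖q - 1‖) ≤ 2 * ‖q - 1‖)
    (hl : y ^ l * (1 + ‖q - 1‖) ≤ 2 * ‖q - 1‖) (h₁ : InRegion q y k S₁ D₁)
    (h₂ : InRegion q y l S₂ D₂) :
    InRegion q y 1 (S₁ * S₂ + (q - 1) * (D₁ * D₂))
      (S₁ * D₂ + D₁ * S₂ + (q - 2) * (D₁ * D₂)) := by
  have hQ := hg.one_lt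
  have b₁ := h₁.mul_norm_le hQ hk
  have b₂ := h₂.mul_norm_le hQ hl
  set Q := ‖q - 1‖
  have hQ0 : 0 < Q := by linarith
  refine ⟨?_, .inr ⟨1 / Q ^ 2, by positivity, ?_, ?_⟩⟩
  · rw [series_total]
    exact mul_ne_zero h₁.1 h₂.1
  · rw [series_total, show S₁ * S₂ + (q - 1) * (D₁ * D₂) - (S₁ * D₂ + D₁ * S₂ +
      (q - 2) * (D₁ * D₂)) = (S₁ - D₁) * (S₂ - D₂) by ring, norm_mul, norm_mul, one_div,
      ← div_eq_inv_mul, le_div_iff₀ (by positivity)]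
    calc ‖S₁ - D₁‖ * ‖S₂ - D₂‖ * Q ^ 2 = (Q * ‖S₁ - D₁‖) * (Q * ‖S₂ - D₂‖) := by ring
      _ ≤ _ := by gcongr
  · have := hg.le_mul
    rw [pow_one]
    field_simp
    linarith

/-- The parallel law is t = (t₁ + t₂ + (q - 2) t₁ t₂) / (1 + (q - 1) t₁ t₂). The triangle inequality
bounds |t| by its value at q = 1 - Q with tᵢ = -rᵢ, up to sign. The size conditions are imposed on k
and l only, not on k + l. -/
theorem InRegion.parallel (hQ : 1 < ‖q - 1‖) (hk : y ^ k * (1 + ‖q - 1‖) ≤ 2 * ‖q - 1‖)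
    (hl : y ^ l * (1 + ‖q - 1‖) ≤ 2 * ‖q - 1‖) (hy : 0 ≤ y) (h₁ : InRegion q y k S₁ D₁)
    (h₂ : InRegion q y l S₂ D₂) :
    InRegion q y (k + l) (S₁ * S₂) (D₁ * D₂) := by
  have b₁ := h₁.mul_norm_le hQ hk
  have b₂ := h₂.mul_norm_le hQ hl
  have hq0 : q ≠ 0 := by
    rintro rfl
    simp at hQ
  have hq : 0 < ‖q‖ := norm_pos_iff.2 hq0
  have hT : q * (S₁ * S₂ + (q - 1) * (D₁ * D₂)) = (S₁ + (q - 1) * D₁) * (S₂ + (q - 1) * D₂) +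
    (q - 1) * ((S₁ - D₁) * (S₂ - D₂)) := by ring
  have hB : q * (S₁ * S₂ - D₁ * D₂) = (S₁ + (q - 1) * D₁) * (S₂ - D₂) +
    (S₁ - D₁) * (S₂ + (q - 1) * D₂) + (q - 2) * ((S₁ - D₁) * (S₂ - D₂)) := by ring
  have n₁ := norm_pos_iff.2 h₁.1
  have n₂ := norm_pos_iff.2 h₂.1
  have hq2 : ‖q - 2‖ ≤ ‖q - 1‖ + 1 := by
    calc ‖q - 2‖ = ‖(q - 1) - 1‖ := by ring_nf
      _ ≤ ‖q - 1‖ + ‖(1 : ℂ)‖ := norm_sub_le _ _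
      _ = _ := by simp
  have hTn := congrArg norm hT
  have hBn := congrArg norm hB
  rw [norm_mul] at hTn hBn
  obtain ⟨-, c₁⟩ := h₁
  obtain ⟨-, c₂⟩ := h₂
  generalize S₁ + (q - 1) * D₁ = T₁ at *
  generalize S₂ + (q - 1) * D₂ = T₂ at *
  generalize S₁ - D₁ = B₁ at *
  generalize S₂ - D₂ = B₂ at *
  generalize hT' : S₁ * S₂ + (q - 1) * (D₁ * D₂) = T at *
  generalize hB' : S₁ * S₂ - D₁ * D₂ = B at *
  have hlow : ‖T₁‖ * ‖T₂‖ - ‖q - 1‖ * (‖B₁‖ * ‖B₂‖) ≤ ‖q‖ * ‖T‖ := by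
    rw [hTn, ← norm_mul, ← norm_mul, ← norm_mul]
    have := norm_sub_le (T₁ * T₂ + (q - 1) * (B₁ * B₂)) ((q - 1) * (B₁ * B₂))
    rw [add_sub_cancel_right] at this
    linarith
  have hup : ‖q‖ * ‖B‖ ≤ ‖T₁‖ * ‖B₂‖ + ‖B₁‖ * ‖T₂‖ + (‖q - 1‖ + 1) * (‖B₁‖ * ‖B₂‖) := by
    rw [hBn]
    refine (norm_add₃_le).trans ?_
    simp only [norm_mul]
    gcongr
  -- Since |t₁|, |t₂| ≤ 1/Q and Q > 1, the product Q |t₁ t₂| is less than 1.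
  have hTne : T ≠ 0 := by
    rintro rfl
    rw [norm_zero, mul_zero] at hlow
    have : (‖q - 1‖ * ‖B₁‖) * (‖q - 1‖ * ‖B₂‖) ≤ ‖T₁‖ * ‖T₂‖ := by gcongr
    nlinarith [mul_pos n₁ n₂]
  refine ⟨hT' ▸ hTne, ?_⟩
  rw [hT', hB']
  -- A factor that behaves like a single edge makes the whole composition behave like one.
  rcases c₁ with rfl | ⟨r₁, hr₁, c₁, d₁⟩
  · exact .inl (zero_mul _)
  rcases c₂ with rfl | ⟨r₂, hr₂, c₂, d₂⟩
  · exact .inl (mul_zero _)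
  right
  have e₁ := mul_le_one_of_le hQ hr₁ hk d₁
  have e₂ := mul_le_one_of_le hQ hr₂ hl d₂
  set Q := ‖q - 1‖
  have hQ0 : 0 < Q := by linarith
  have hden : 0 < 1 - Q * (r₁ * r₂) := by
    have : (Q * r₁) * (Q * r₂) ≤ 1 * 1 := by gcongr
    nlinarith [mul_nonneg hr₁ hr₂]
  refine ⟨(r₁ + r₂ + (Q + 1) * (r₁ * r₂)) / (1 - Q * (r₁ * r₂)), by positivity, ?_, ?_⟩
  · have hup' : ‖q‖ * ‖B‖ ≤ (r₁ + r₂ + (Q + 1) * (r₁ * r₂)) * (‖T₁‖ * ‖T₂‖) := by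
      refine hup.trans ?_
      calc _ ≤ ‖T₁‖ * (r₂ * ‖T₂‖) + (r₁ * ‖T₁‖) * ‖T₂‖ +
            (Q + 1) * ((r₁ * ‖T₁‖) * (r₂ * ‖T₂‖)) := by gcongr
        _ = _ := by ring
    have hlow' : (1 - Q * (r₁ * r₂)) * (‖T₁‖ * ‖T₂‖) ≤ ‖q‖ * ‖T‖ := by
      refine le_trans ?_ hlow
      have : Q * (‖B₁‖ * ‖B₂‖) ≤ Q * ((r₁ * ‖T₁‖) * (r₂ * ‖T₂‖)) := by gcongr
      linarith
    rw [div_mul_eq_mul_div, le_div_iff₀ hden]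
    refine le_of_mul_le_mul_left ?_ hq
    calc ‖q‖ * (‖B‖ * (1 - Q * (r₁ * r₂))) = (‖q‖ * ‖B‖) * (1 - Q * (r₁ * r₂)) := by ring
      _ ≤ ((r₁ + r₂ + (Q + 1) * (r₁ * r₂)) * (‖T₁‖ * ‖T₂‖)) * (1 - Q * (r₁ * r₂)) := by gcongr
      _ = (r₁ + r₂ + (Q + 1) * (r₁ * r₂)) * ((1 - Q * (r₁ * r₂)) * (‖T₁‖ * ‖T₂‖)) := by ring
      _ ≤ (r₁ + r₂ + (Q + 1) * (r₁ * r₂)) * (‖q‖ * ‖T‖) := by gcongr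
      _ = _ := by ring
  -- Both 1 + Q r and 1 + r factor over the common denominator, so their quotient is multiplicative.
  · have l1 : 1 + Q * ((r₁ + r₂ + (Q + 1) * (r₁ * r₂)) / (1 - Q * (r₁ * r₂))) =
        (1 + Q * r₁) * (1 + Q * r₂) / (1 - Q * (r₁ * r₂)) := by
      rw [eq_div_iff hden.ne', add_mul, mul_assoc, div_mul_cancel₀ _ hden.ne']
      ring
    have l2 : 1 + (r₁ + r₂ + (Q + 1) * (r₁ * r₂)) / (1 - Q * (r₁ * r₂)) =
        (1 + r₁) * (1 + r₂) / (1 - Q * (r₁ * r₂)) := by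
      rw [eq_div_iff hden.ne', add_mul, div_mul_cancel₀ _ hden.ne']
      ring
    rw [l1, l2, ← mul_div_assoc]
    refine div_le_div_of_nonneg_right ?_ hden.le
    calc (1 + Q * r₁) * (1 + Q * r₂) ≤ (y ^ k * (1 + r₁)) * (y ^ l * (1 + r₂)) := by gcongr
      _ = _ := by rw [pow_add]; ring

theorem inRegion_edge (hQ : 1 < ‖q - 1‖) : InRegion q y 1 0 1 := by
  refine ⟨?_, .inl rfl⟩
  rw [zero_add, mul_one, ← norm_pos_iff]
  linarith

/-- Here t = 2 / ((q - 1)(q - 2)) and |q - 2| ≥ Q - 1, so r = 2 / (Q (Q - 1)) works; its value of (1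
+ Q r) / (1 + r) is exactly y². -/
theorem inRegion_bridge (hg : IsGrowth ‖q - 1‖ y) :
    InRegion q y 2 ((q - 1) * (q - 2)) ((q - 2) * (q - 3)) := by
  have hQ := hg.one_lt
  have hy := hg.sq_mul_eq
  have h1 : ‖q - 1‖ - 1 ≤ ‖q - 2‖ := by
    have := norm_sub_norm_le (q - 1) 1
    rw [norm_one] at this
    refine this.trans (le_of_eq ?_)
    ring_nf
  set Q := ‖q - 1‖ with hQdef
  have hQ0 : 0 < Q := by linarith
  have hQ1 : 0 < Q - 1 := by linarith
  have hT : (q - 1) * (q - 2) + (q - 1) * ((q - 2) * (q - 3)) = (q - 1) * (q - 2) * (q - 2) := by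
    ring
  have hB : (q - 1) * (q - 2) - (q - 2) * (q - 3) = 2 * (q - 2) := by ring
  have h2 : 0 < ‖q - 2‖ := by linarith
  refine ⟨?_, .inr ⟨2 / (Q * (Q - 1)), by positivity, ?_, ?_⟩⟩
  · rw [hT, ← norm_pos_iff, norm_mul, norm_mul]
    positivity
  · rw [hT, hB, norm_mul, norm_mul, norm_mul, ← hQdef, Complex.norm_ofNat]
    rw [div_mul_eq_mul_div, le_div_iff₀ (by positivity)]
    calc 2 * ‖q - 2‖ * (Q * (Q - 1)) ≤ 2 * ‖q - 2‖ * (Q * ‖q - 2‖) := by gcongr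
      _ = _ := by ring
  · have l1 : 1 + Q * (2 / (Q * (Q - 1))) = Q * (Q + 1) / (Q * (Q - 1)) := by
      field_simp
      ring
    have l2 : 1 + 2 / (Q * (Q - 1)) = (Q ^ 2 - Q + 2) / (Q * (Q - 1)) := by
      field_simp
    rw [l1, l2, ← mul_div_assoc, hy]

/-- Below the radius there is a base `y` whose powers up to `Λ - 1` are under control. -/
theorem exists_isGrowth {Λ : ℕ} (hΛ : 1 ≤ Λ) {Q : ℝ} (hQ : 1 < Q)
    (h : (1 + 1 / Q) ^ (Λ + 1) ≤ 4 * (1 - 1 / Q + 2 * (1 / Q) ^ 2) ^ (Λ - 1)) :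
    ∃ y, IsGrowth Q y ∧ ∀ k, k + 1 ≤ Λ → y ^ k * (1 + Q) ≤ 2 * Q := by
  have hQ0 : 0 < Q := by linarith
  have hc : 0 < Q ^ 2 - Q + 2 := by nlinarith
  -- The equality required by the bridge leaves only this square root as a nonnegative candidate for
  -- y.
  have hs : Real.sqrt (Q * (Q + 1) / (Q ^ 2 - Q + 2)) ^ 2 = Q * (Q + 1) / (Q ^ 2 - Q + 2) :=
    Real.sq_sqrt (by positivity)
  have hs0 := Real.sqrt_nonneg (Q * (Q + 1) / (Q ^ 2 - Q + 2))
  generalize Real.sqrt (Q * (Q + 1) / (Q ^ 2 - Q + 2)) = y at hs hs0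
  have hy : y ^ 2 * (Q ^ 2 - Q + 2) = Q * (Q + 1) := by
    rw [hs, div_mul_cancel₀ _ hc.ne']
  have hy1 : 1 ≤ y := by
    have : 1 ≤ y ^ 2 := by
      rw [hs, le_div_iff₀ hc]; nlinarith
    nlinarith
  refine ⟨y, ⟨hQ, hy1, ?_, hy⟩, fun k hk => ?_⟩
  · refine le_of_sq_le_sq ?_ (by positivity)
    -- This reduces to (Q² + 1)² - Q(Q + 1)(Q² - Q + 2) = (Q - 1)² ≥ 0.
    have : (Q * (Q + 1)) ^ 2 * (Q ^ 2 - Q + 2) ≤ (y * (Q ^ 2 + 1)) ^ 2 * (Q ^ 2 - Q + 2) := by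
      calc (Q * (Q + 1)) ^ 2 * (Q ^ 2 - Q + 2)
          = (Q * (Q + 1)) * ((Q * (Q + 1)) * (Q ^ 2 - Q + 2)) := by ring
        _ ≤ (Q * (Q + 1)) * (Q ^ 2 + 1) ^ 2 := by
          gcongr
          nlinarith [sq_nonneg (Q - 1)]
        _ = (y ^ 2 * (Q ^ 2 - Q + 2)) * (Q ^ 2 + 1) ^ 2 := by rw [hy]
        _ = _ := by ring
    exact le_of_mul_le_mul_right this hc
  · have hle : y ^ k ≤ y ^ (Λ - 1) := pow_le_pow_right₀ hy1 (by omega)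
    -- Squaring turns y into y², a rational function of Q, and gives the hypothesis with
    -- denominators cleared.
    have hmain : y ^ (Λ - 1) * (1 + Q) ≤ 2 * Q := by
      refine le_of_sq_le_sq ?_ (by positivity)
      obtain ⟨n, rfl⟩ : ∃ n, Λ = n + 1 := ⟨Λ - 1, by omega⟩
      rw [Nat.add_sub_cancel] at h ⊢
      have e1 : 1 + 1 / Q = (Q + 1) / Q := by field_simp
      have e2 : 1 - 1 / Q + 2 * (1 / Q) ^ 2 = (Q ^ 2 - Q + 2) / Q ^ 2 := by field_simp
      rw [e1, e2, div_pow, div_pow, ← mul_div_assoc, div_le_div_iff₀ (by positivity)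
        (by positivity)] at h
      have hpos : 0 < (Q ^ 2 - Q + 2) ^ n * Q ^ n := by positivity
      refine le_of_mul_le_mul_right ?_ hpos
      have hpos' : 0 < Q ^ n := by positivity
      have e3 : (y ^ n) ^ 2 * (Q ^ 2 - Q + 2) ^ n = (Q * (Q + 1)) ^ n := by
        rw [← hy, mul_pow, ← pow_mul, ← pow_mul, mul_comm n 2]
      calc (y ^ n * (1 + Q)) ^ 2 * ((Q ^ 2 - Q + 2) ^ n * Q ^ n)
          = ((y ^ n) ^ 2 * (Q ^ 2 - Q + 2) ^ n) * ((1 + Q) ^ 2 * Q ^ n) := by ring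
        _ = (Q + 1) ^ (n + 1 + 1) * (Q ^ 2) ^ n := by rw [e3, mul_pow]; ring
        _ ≤ 4 * (Q ^ 2 - Q + 2) ^ n * Q ^ (n + 1 + 1) := h
        _ = (2 * Q) ^ 2 * ((Q ^ 2 - Q + 2) ^ n * Q ^ n) := by ring
    refine le_trans ?_ hmain
    gcongr

end Transmissivity

/-! ### Edge-disjoint walks -/

namespace Graph

variable {α β : Type*} {G G₁ G₂ H : Graph α β} {x y z s t m : α} {vs : List α} {es es' : List β}
  {k l : ℕ} {Λ : ℕ∞}

/-- `es` is the list of edges of a walk in `G` from `x` to `y`. -/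
def IsWalkEdges (G : Graph α β) (x y : α) (es : List β) : Prop :=
  ∃ vs : List α, G.IsWalk x y vs es

theorem IsWalk.mono (h : G ≤ H) (w : G.IsWalk x y vs es) : H.IsWalk x y vs es := by
  induction w with
  | nil x hx => exact .nil x (h.vertexSet_mono hx)
  | cons e x y z vs es he _ ih => exact .cons e x y z vs es (he.mono h) ih

theorem IsWalkEdges.mono (h : G ≤ H) : G.IsWalkEdges x y es → H.IsWalkEdges x y es :=
  fun ⟨vs, w⟩ => ⟨vs, w.mono h⟩

theorem IsWalkEdges.mem_edgeSet (w : G.IsWalkEdges x y es) {e : β} (he : e ∈ es) : e ∈ E(G) := by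
  obtain ⟨vs, w⟩ := w
  induction w with
  | nil => simp at he
  | cons e' x y z vs es hl _ ih =>
    rcases List.mem_cons.1 he with rfl | he
    · exact hl.edge_mem
    · exact ih he

theorem IsWalkEdges.append (w : G.IsWalkEdges x y es) (w' : G.IsWalkEdges y z es') :
    G.IsWalkEdges x z (es ++ es') := by
  obtain ⟨vs, w⟩ := w
  induction w with
  | nil => exact w'
  | cons e x y z vs es hl _ ih =>
    obtain ⟨vs', w''⟩ := ih w'
    exact ⟨_, .cons e _ _ _ _ _ hl w''⟩

theorem IsLink.isWalkEdges {e : β} (h : G.IsLink e x y) : G.IsWalkEdges x y [e] :=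
  ⟨_, .cons e x y y _ _ h (.nil y h.right_mem)⟩

theorem IsWalkEdges.reverse (w : G.IsWalkEdges x y es) : G.IsWalkEdges y x es.reverse := by
  obtain ⟨vs, w⟩ := w
  induction w with
  | nil x hx => exact ⟨_, .nil x hx⟩
  | cons e x y z vs es hl _ ih =>
    rw [List.reverse_cons]
    exact ih.append hl.symm.isWalkEdges

/-- Used for loop erasure: when a path is extended by a vertex it already visits, the part before
that visit is dropped. -/
theorem IsWalk.exists_suffix (w : G.IsWalk x y vs es) (hvs : vs.Nodup) (hz : z ∈ vs) :
    ∃ vs' es', G.IsWalk z y vs' es' ∧ vs'.Nodup ∧ es' ⊆ es := by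
  induction w with
  | nil x hx =>
    obtain rfl := List.mem_singleton.1 hz
    exact ⟨_, _, .nil z hx, hvs, List.Subset.refl _⟩
  | cons e x y u vs es hl w ih =>
    rcases List.mem_cons.1 hz with rfl | hz
    · exact ⟨_, _, .cons e z y u vs es hl w, hvs, List.Subset.refl _⟩
    · obtain ⟨vs', es', w', hn, hs⟩ := ih hvs.of_cons hz
      exact ⟨vs', es', w', hn, List.Subset.trans hs (List.subset_cons_self _ _)⟩

/-- Every walk contains a path with the same ends. -/
theorem IsWalkEdges.exists_isPath (w : G.IsWalkEdges x y es) :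
    ∃ es', es' ⊆ es ∧ G.IsPath x y es' := by
  obtain ⟨vs, w⟩ := w
  induction w with
  | nil x hx => exact ⟨[], List.Subset.refl _, [x], .nil x hx, List.nodup_singleton x⟩
  | cons e x y u vs es hl w ih =>
    obtain ⟨es', hs, vs', w', hn⟩ := ih
    by_cases hx : x ∈ vs'
    · obtain ⟨vs'', es'', w'', hn', hs'⟩ := w'.exists_suffix hn hx
      exact ⟨es'', List.Subset.trans hs' (List.Subset.trans hs (List.subset_cons_self _ _)),
        vs'', w'', hn'⟩
    · exact ⟨e :: es', List.cons_subset_cons e hs, x :: vs', .cons e x y u vs' es' hl w',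
        List.nodup_cons.2 ⟨hx, hn⟩⟩

/-- There are `k` pairwise edge-disjoint walks in `G` from `x` to `y`. -/
def HasDisjointWalks (G : Graph α β) (x y : α) (k : ℕ) : Prop :=
  ∃ P : Fin k → List β,
    (∀ i, G.IsWalkEdges x y (P i)) ∧ ∀ i j, i ≠ j → (P i).Disjoint (P j)

/-- A path extracted from a walk uses only edges of that walk, so disjointness survives. Walks
suffice from here on, and they can be concatenated freely. -/
theorem HasDisjointWalks.hasEdgeDisjointPaths (h : G.HasDisjointWalks x y k) :
    G.HasEdgeDisjointPaths x y k := by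
  obtain ⟨P, hP, hd⟩ := h
  choose Q hQ hQ' using fun i => (hP i).exists_isPath
  exact ⟨Q, hQ', fun i j hij e hi hj => hd i j hij (hQ i hi) (hQ j hj)⟩

theorem HasEdgeDisjointPaths.le_maxmaxflow (h : G.HasEdgeDisjointPaths x y k) (hx : x ∈ V(G))
    (hy : y ∈ V(G)) (hxy : x ≠ y) : (k : ℕ∞) ≤ G.maxmaxflow :=
  calc (k : ℕ∞) ≤ G.maxFlow x y := le_iSup₂_of_le k h le_rfl
    _ ≤ _ := le_iSup₂_of_le x hx (le_iSup₂_of_le y hy (le_iSup (fun _ : x ≠ y => G.maxFlow x y) hxy))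

theorem maxmaxflow_mono (h : G ≤ H) : G.maxmaxflow ≤ H.maxmaxflow := by
  refine iSup₂_le fun x hx => iSup₂_le fun y hy => iSup_le fun hxy => iSup₂_le fun k hk => ?_
  obtain ⟨P, hP, hd⟩ := hk
  have hk' : H.HasEdgeDisjointPaths x y k :=
    ⟨P, fun i => let ⟨vs, w, hn⟩ := hP i; ⟨vs, w.mono h, hn⟩, hd⟩
  exact hk'.le_maxmaxflow (h.vertexSet_mono hx) (h.vertexSet_mono hy) hxy

theorem HasDisjointWalks.one (w : G.IsWalkEdges x y es) : G.HasDisjointWalks x y 1 :=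
  ⟨fun _ => es, fun _ => w, fun i j hij => absurd (Subsingleton.elim i j) hij⟩

theorem HasDisjointWalks.exists_isWalkEdges (h : G.HasDisjointWalks x y k) (hk : 1 ≤ k) :
    ∃ es, G.IsWalkEdges x y es :=
  let ⟨P, hP, _⟩ := h
  ⟨P ⟨0, hk⟩, hP _⟩

theorem HasDisjointWalks.mono_right (h : G.HasDisjointWalks x y k) (hlk : l ≤ k) :
    G.HasDisjointWalks x y l :=
  let ⟨P, hP, hd⟩ := h
  ⟨fun i => P (i.castLE hlk), fun _ => hP _, fun _ _ hij => hd _ _ fun h =>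
    hij (Fin.castLE_injective hlk h)⟩

theorem HasDisjointWalks.add (h₁ : G₁ ≤ G) (h₂ : G₂ ≤ G) (hd : Disjoint E(G₁) E(G₂))
    (w₁ : G₁.HasDisjointWalks x y k) (w₂ : G₂.HasDisjointWalks x y l) :
    G.HasDisjointWalks x y (k + l) := by
  obtain ⟨P, hP, hPd⟩ := w₁
  obtain ⟨Q, hQ, hQd⟩ := w₂
  have hPQ : ∀ i j, (P i).Disjoint (Q j) := fun i j e he he' =>
    Set.disjoint_left.1 hd ((hP i).mem_edgeSet he) ((hQ j).mem_edgeSet he')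
  refine ⟨Fin.append P Q, fun i => ?_, fun i j => ?_⟩
  · induction i using Fin.addCases with
    | left i => rw [Fin.append_left]; exact (hP i).mono h₁
    | right i => rw [Fin.append_right]; exact (hQ i).mono h₂
  · induction i using Fin.addCases with
    | left i =>
      induction j using Fin.addCases with
      | left j =>
        rw [Fin.append_left, Fin.append_left]
        exact fun hij => hPd i j fun h => hij (by rw [h])
      | right j => rw [Fin.append_left, Fin.append_right]; exact fun _ => hPQ i j
    | right i =>
      induction j using Fin.addCases with
      | left j => rw [Fin.append_left, Fin.append_right]; exact fun _ => (hPQ j i).symm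
      | right j =>
        rw [Fin.append_right, Fin.append_right]
        exact fun hij => hQd i j fun h => hij (by rw [h])

theorem HasDisjointWalks.append (h₁ : G₁ ≤ G) (h₂ : G₂ ≤ G) (hd : Disjoint E(G₁) E(G₂))
    (w₁ : G₁.HasDisjointWalks x y k) (w₂ : G₂.HasDisjointWalks y z k) :
    G.HasDisjointWalks x z k := by
  obtain ⟨P, hP, hPd⟩ := w₁
  obtain ⟨Q, hQ, hQd⟩ := w₂
  have hPQ : ∀ i j, (P i).Disjoint (Q j) := fun i j e he he' =>
    Set.disjoint_left.1 hd ((hP i).mem_edgeSet he) ((hQ j).mem_edgeSet he')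
  refine ⟨fun i => P i ++ Q i, fun i => ((hP i).mono h₁).append ((hQ i).mono h₂),
    fun i j hij => ?_⟩
  rw [List.disjoint_append_left, List.disjoint_append_right, List.disjoint_append_right]
  exact ⟨⟨hPd i j hij, hPQ i j⟩, (hPQ j i).symm, hQd i j hij⟩

/-- There is a walk in `H` from `x` to `y` which uses no edge of `G`. -/
def HasDetour (G H : Graph α β) (x y : α) : Prop :=
  ∃ es, H.IsWalkEdges x y es ∧ ∀ e ∈ es, e ∉ E(G)

/-- The detour is one more walk, disjoint from the k walks inside G. This is the source of the
exponent Λ - 1. -/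
theorem HasDisjointWalks.succ_le (h : G.HasDisjointWalks x y k) (hGH : G ≤ H)
    (hd : G.HasDetour H x y) (hx : x ∈ V(G)) (hy : y ∈ V(G)) (hxy : x ≠ y)
    (hH : H.maxmaxflow ≤ Λ) : ((k + 1 : ℕ) : ℕ∞) ≤ Λ := by
  obtain ⟨P, hP, hPd⟩ := h
  obtain ⟨es, w, hes⟩ := hd
  have hw : H.HasDisjointWalks x y (k + 1) := by
    have hPe : ∀ i, es.Disjoint (P i) := fun i e he he' => hes e he ((hP i).mem_edgeSet he')
    refine ⟨Fin.cons es P, fun i => ?_, fun i j => ?_⟩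
    · induction i using Fin.cases with
      | zero => exact w
      | succ i => exact (hP i).mono hGH
    · induction i using Fin.cases with
      | zero =>
        induction j using Fin.cases with
        | zero => exact fun h => absurd rfl h
        | succ j => exact fun _ => hPe j
      | succ i =>
        induction j using Fin.cases with
        | zero => exact fun _ => (hPe i).symm
        | succ j => exact fun hij => hPd i j fun h => hij (by rw [h])
  exact (hw.hasEdgeDisjointPaths.le_maxmaxflow (hGH.vertexSet_mono hx) (hGH.vertexSet_mono hy)
    hxy).trans hH

theorem HasDetour.anti_left (h : G₁ ≤ G) (hd : G.HasDetour H x y) : G₁.HasDetour H x y :=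
  let ⟨es, w, hes⟩ := hd
  ⟨es, w, fun e he he' => hes e he (h.edgeSet_mono he')⟩

theorem HasDetour.symm (hd : G.HasDetour H x y) : G.HasDetour H y x :=
  let ⟨es, w, hes⟩ := hd
  ⟨es.reverse, w.reverse, fun e he => hes e (List.mem_reverse.1 he)⟩

theorem HasDetour.trans (hd : G.HasDetour H x y) (hd' : G.HasDetour H y z) :
    G.HasDetour H x z :=
  let ⟨es, w, hes⟩ := hd
  let ⟨es', w', hes'⟩ := hd'
  ⟨es ++ es', w.append w', fun e he => (List.mem_append.1 he).elim (hes e) (hes' e)⟩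

theorem IsWalkEdges.hasDetour (w : G₂.IsWalkEdges x y es) (h : G₂ ≤ H)
    (hd : Disjoint E(G₁) E(G₂)) : G₁.HasDetour H x y :=
  ⟨es, w.mono h, fun _ he he' => Set.disjoint_left.1 hd he' (w.mem_edgeSet he)⟩

theorem IsEdgeDisjointUnion.left_le (h : G.IsEdgeDisjointUnion G₁ G₂) : G₁ ≤ G :=
  ⟨h.vertexSet_eq ▸ Set.subset_union_left, fun {_ _ _} hl => (h.isLink_iff _ _ _).2 (.inl hl)⟩

theorem IsEdgeDisjointUnion.right_le (h : G.IsEdgeDisjointUnion G₁ G₂) : G₂ ≤ G :=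
  ⟨h.vertexSet_eq ▸ Set.subset_union_right, fun {_ _ _} hl => (h.isLink_iff _ _ _).2 (.inr hl)⟩

theorem IsEdgeDisjointUnion.edgeSet_eq (h : G.IsEdgeDisjointUnion G₁ G₂) :
    E(G) = E(G₁) ∪ E(G₂) := by
  ext e
  simp only [Set.mem_union, edge_mem_iff_exists_isLink, h.isLink_iff, exists_or]

end Graph

/-! ### Proper colourings -/

namespace Graph

variable {α β C : Type*} {G G₁ G₂ : Graph α β} {s t m : α} {a b c : C}

/-- Adjacent vertices have different colours. -/
def IsProperColoring (G : Graph α β) (σ : V(G) → C) : Prop :=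
  ∀ e (x y : V(G)), G.IsLink e x y → σ x ≠ σ y

/-- The proper colourings of `G` with colour `a` at `s` and colour `b` at `t`. -/
def TerminalColoring (G : Graph α β) (s t : α) (a b : C) : Type _ :=
  {σ : V(G) → C // G.IsProperColoring σ ∧ (∀ x, x.1 = s → σ x = a) ∧ ∀ x, x.1 = t → σ x = b}

/-- Turns n ^ k(A) into the number of n-colourings for which every edge of A is monochromatic. -/
theorem card_quot_fun {V : Type*} [Finite V] (r : V → V → Prop) (C : Type*) :
    Nat.card {f : V → C // ∀ x y, r x y → f x = f y} = Nat.card C ^ Nat.card (Quot r) := by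
  have : Finite (Quot r) := Quot.finite r
  rw [← Nat.card_fun]
  exact Nat.card_congr
    { toFun := fun f => Quot.lift f.1 f.2
      invFun := fun g => ⟨g ∘ Quot.mk r, fun _ _ h => congrArg g (Quot.sound h)⟩
      left_inv := fun _ => rfl
      right_inv := fun g => funext fun z => by
        induction z using Quot.ind
        rfl }

theorem chromaticPolynomial_eq_sum (E : Finset β) (hE : (E : Set β) = E(G)) :
    G.chromaticPolynomial =
      ∑ A ∈ E.powerset, Polynomial.X ^ G.numComponents (A : Set β) * (-1 : ℤ[X]) ^ A.card := by
  unfold chromaticPolynomial multivariateTutte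
  have h : 𝒫 E(G) = (fun A : Finset β => (A : Set β)) '' (E.powerset : Set (Finset β)) := by
    ext A
    simp only [Set.mem_powerset_iff, Set.mem_image, Finset.coe_powerset, Set.mem_preimage]
    constructor
    · intro hA
      have hf : A.Finite := E.finite_toSet.subset (hE ▸ hA)
      exact ⟨hf.toFinset, by simpa [hE] using hA, hf.coe_toFinset⟩
    · rintro ⟨A, hA, rfl⟩
      exact hE ▸ hA
  rw [h, finsum_mem_image Finset.coe_injective.injOn, finsum_mem_coe_finset]
  refine Finset.sum_congr rfl fun A _ => ?_
  rw [finprod_mem_coe_finset, Finset.prod_const]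

/-- The ends of an edge are determined up to order, so being monochromatic can be tested on any one
pair of ends. -/
theorem exists_link_eq_iff {e : β} {σ : V(G) → C} (he : e ∈ E(G)) :
    (∀ x y : V(G), G.IsLink e x y → σ x = σ y) ↔ ∃ x y : V(G), G.IsLink e x y ∧ σ x = σ y := by
  obtain ⟨u, v, huv⟩ := exists_isLink_of_mem_edgeSet he
  refine ⟨fun h => ⟨⟨u, huv.left_mem⟩, ⟨v, huv.right_mem⟩, huv, h _ _ huv⟩, ?_⟩
  rintro ⟨x, y, hxy, hσ⟩ x' y' hxy'
  rcases hxy.eq_and_eq_or_eq_and_eq hxy' with ⟨h1, h2⟩ | ⟨h1, h2⟩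
  · rw [← Subtype.ext h1, ← Subtype.ext h2, hσ]
  · rw [← Subtype.ext h1, ← Subtype.ext h2, hσ]

/-- The chromatic polynomial counts proper colourings. -/
theorem eval_chromaticPolynomial (hV : V(G).Finite) (hE : E(G).Finite) (n : ℕ) :
    G.chromaticPolynomial.eval (n : ℤ) =
      Nat.card {σ : V(G) → Fin n // G.IsProperColoring σ} := by
  classical
  have := hV.fintype
  rw [chromaticPolynomial_eq_sum hE.toFinset hE.coe_toFinset, Polynomial.eval_finsetSum]
  set E := hE.toFinset
  -- `M σ` is the set of monochromatic edges; σ is proper exactly when it is empty.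
  let M : (V(G) → Fin n) → Finset β :=
    fun σ => E.filter fun e => ∃ x y : V(G), G.IsLink e x y ∧ σ x = σ y
  have h1 : ∀ A ∈ E.powerset, ((n : ℤ) ^ G.numComponents (A : Set β)) =
      ∑ σ : V(G) → Fin n, if A ⊆ M σ then 1 else 0 := by
    intro A hA
    rw [numComponents, ← Nat.cast_pow]
    have := card_quot_fun (fun x y : V(G) => ∃ e ∈ (A : Set β), G.IsLink e x y) (Fin n)
    rw [Nat.card_fin] at this
    rw [← this, Nat.card_eq_fintype_card, Fintype.card_subtype, Finset.sum_boole]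
    congr 2
    ext σ
    simp only [Finset.mem_filter, Finset.mem_univ, true_and]
    constructor
    · intro h e he
      have heE := Finset.mem_powerset.1 hA he
      exact Finset.mem_filter.2 ⟨heE, (exists_link_eq_iff (hE.mem_toFinset.1 heE)).1
        fun x y hxy => h x y ⟨e, he, hxy⟩⟩
    · rintro h x y ⟨e, he, hxy⟩
      have he' := Finset.mem_filter.1 (h he)
      exact (exists_link_eq_iff (hE.mem_toFinset.1 he'.1)).2 he'.2 x y hxy
  calc ∑ A ∈ E.powerset, (Polynomial.X ^ G.numComponents (A : Set β) *
        (-1 : ℤ[X]) ^ A.card).eval (n : ℤ)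
      = ∑ A ∈ E.powerset, ∑ σ : V(G) → Fin n, if A ⊆ M σ then (-1 : ℤ) ^ A.card else 0 := by
        refine Finset.sum_congr rfl fun A hA => ?_
        rw [Polynomial.eval_mul, Polynomial.eval_pow, Polynomial.eval_X, h1 A hA, Finset.sum_mul]
        simp
    _ = ∑ σ : V(G) → Fin n, ∑ A ∈ E.powerset, if A ⊆ M σ then (-1 : ℤ) ^ A.card else 0 :=
        Finset.sum_comm
    _ = ∑ σ : V(G) → Fin n, if M σ = ∅ then 1 else 0 := by
        refine Finset.sum_congr rfl fun σ _ => ?_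
        -- Inclusion-exclusion: the alternating sum over the subsets of `M σ` vanishes unless `M σ`
        -- is empty.
        rw [← Finset.sum_filter, ← Finset.sum_powerset_neg_one_pow_card]
        congr 1
        ext A
        simp only [Finset.mem_filter, Finset.mem_powerset]
        exact ⟨fun h => h.2, fun h => ⟨h.trans (Finset.filter_subset _ _), h⟩⟩
    _ = _ := by
        rw [Finset.sum_boole, Nat.card_eq_fintype_card, Fintype.card_subtype]
        congr 2
        ext σ
        rw [Finset.mem_filter_univ, Finset.mem_filter_univ, Finset.filter_eq_empty_iff]
        exact ⟨fun h e x y hxy hσ => h (hE.mem_toFinset.2 hxy.edge_mem) ⟨x, y, hxy, hσ⟩,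
          fun h e _ ⟨x, y, hxy, hσ⟩ => h e x y hxy hσ⟩

/-! ### Colourings of parallel and series compositions. -/

theorem IsEdgeDisjointUnion.exists_glue (h : G.IsEdgeDisjointUnion G₁ G₂) (σ₁ : V(G₁) → C)
    (σ₂ : V(G₂) → C) (hσ : ∀ x (h₁ : x ∈ V(G₁)) (h₂ : x ∈ V(G₂)), σ₁ ⟨x, h₁⟩ = σ₂ ⟨x, h₂⟩) :
    ∃ σ : V(G) → C, (∀ x : V(G₁), σ ⟨x, h.left_le.vertexSet_mono x.2⟩ = σ₁ x) ∧
      ∀ x : V(G₂), σ ⟨x, h.right_le.vertexSet_mono x.2⟩ = σ₂ x := by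
  classical
  refine ⟨fun x => if hx : x.1 ∈ V(G₁) then σ₁ ⟨x, hx⟩ else σ₂ ⟨x, ?_⟩, fun x => ?_, fun x => ?_⟩
  · exact (h.vertexSet_eq.subset x.2).resolve_left hx
  · exact dif_pos x.2
  · by_cases hx : x.1 ∈ V(G₁)
    · exact (dif_pos hx).trans (hσ x hx x.2)
    · exact dif_neg hx

theorem IsEdgeDisjointUnion.isProperColoring_iff (h : G.IsEdgeDisjointUnion G₁ G₂)
    (σ : V(G) → C) : G.IsProperColoring σ ↔
      G₁.IsProperColoring (fun x => σ ⟨x, h.left_le.vertexSet_mono x.2⟩) ∧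
      G₂.IsProperColoring (fun x => σ ⟨x, h.right_le.vertexSet_mono x.2⟩) := by
  refine ⟨fun hσ => ⟨fun e x y hxy => hσ e _ _ (hxy.mono h.left_le),
    fun e x y hxy => hσ e _ _ (hxy.mono h.right_le)⟩, fun ⟨h₁, h₂⟩ e x y hxy => ?_⟩
  rcases (h.isLink_iff _ _ _).1 hxy with hxy | hxy
  · exact h₁ e ⟨x, hxy.left_mem⟩ ⟨y, hxy.right_mem⟩ hxy
  · exact h₂ e ⟨x, hxy.left_mem⟩ ⟨y, hxy.right_mem⟩ hxy

theorem IsEdgeDisjointUnion.ext_coloring (h : G.IsEdgeDisjointUnion G₁ G₂) {σ τ : V(G) → C}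
    (h₁ : ∀ x : V(G₁), σ ⟨x, h.left_le.vertexSet_mono x.2⟩ =
      τ ⟨x, h.left_le.vertexSet_mono x.2⟩)
    (h₂ : ∀ x : V(G₂), σ ⟨x, h.right_le.vertexSet_mono x.2⟩ =
      τ ⟨x, h.right_le.vertexSet_mono x.2⟩) : σ = τ := by
  funext x
  rcases h.vertexSet_eq.subset x.2 with hx | hx
  · exact h₁ ⟨x, hx⟩
  · exact h₂ ⟨x, hx⟩

/-- The halves meet only in the terminals, whose colours are prescribed, so their colourings combine
independently. -/
theorem IsParallelComposition.card_terminalColoring (h : G.IsParallelComposition G₁ G₂ s t)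
    (a b : C) : Nat.card (G.TerminalColoring s t a b) =
      Nat.card (G₁.TerminalColoring s t a b) * Nat.card (G₂.TerminalColoring s t a b) := by
  have h' := h.toIsEdgeDisjointUnion
  rw [← Nat.card_prod]
  refine Nat.card_congr (Equiv.ofBijective (fun σ =>
    (⟨fun x => σ.1 ⟨x, h'.left_le.vertexSet_mono x.2⟩, ((h'.isProperColoring_iff _).1 σ.2.1).1,
      fun x hx => σ.2.2.1 _ hx, fun x hx => σ.2.2.2 _ hx⟩,
     ⟨fun x => σ.1 ⟨x, h'.right_le.vertexSet_mono x.2⟩, ((h'.isProperColoring_iff _).1 σ.2.1).2,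
      fun x hx => σ.2.2.1 _ hx, fun x hx => σ.2.2.2 _ hx⟩)) ⟨fun σ τ hστ => ?_, ?_⟩)
  · replace hστ := Prod.mk.injEq .. ▸ hστ
    exact Subtype.ext (h'.ext_coloring (fun x => congrFun (congrArg Subtype.val hστ.1) x)
      (fun x => congrFun (congrArg Subtype.val hστ.2) x))
  · rintro ⟨σ₁, σ₂⟩
    obtain ⟨σ, hσ₁, hσ₂⟩ := h'.exists_glue σ₁.1 σ₂.1 fun x h₁ h₂ => by
      have hx : x ∈ V(G₁) ∩ V(G₂) := ⟨h₁, h₂⟩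
      rw [h.inter_eq] at hx
      rcases hx with hx | (hx : x = t)
      · rw [σ₁.2.2.1 _ hx, σ₂.2.2.1 _ hx]
      · rw [σ₁.2.2.2 _ hx, σ₂.2.2.2 _ hx]
    have e₁ := funext hσ₁
    have e₂ := funext hσ₂
    refine ⟨⟨σ, (h'.isProperColoring_iff _).2 ⟨?_, ?_⟩, ?_, ?_⟩, ?_⟩
    · rw [e₁]; exact σ₁.2.1
    · rw [e₂]; exact σ₂.2.1
    · intro x hx
      have hs : s ∈ V(G₁) ∩ V(G₂) := by rw [h.inter_eq]; simp
      rw [← hx] at hs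
      rw [← σ₁.2.2.1 ⟨x, hs.1⟩ hx, ← hσ₁]
    · intro x hx
      have hs : t ∈ V(G₁) ∩ V(G₂) := by rw [h.inter_eq]; simp
      rw [← hx] at hs
      rw [← σ₁.2.2.2 ⟨x, hs.1⟩ hx, ← hσ₁]
    · exact Prod.ext (Subtype.ext e₁) (Subtype.ext e₂)

/-- Once the colour of the only shared vertex m is fixed, the halves are coloured independently. -/
theorem IsSeriesComposition.card_fiber (h : G.IsSeriesComposition G₁ G₂ m)
    (hs : s ∈ V(G₁)) (ht : t ∈ V(G₂)) (hm : m ∈ V(G)) (a b c : C) :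
    Nat.card {σ : G.TerminalColoring s t a b // σ.1 ⟨m, hm⟩ = c} =
      Nat.card (G₁.TerminalColoring s m a c) * Nat.card (G₂.TerminalColoring m t c b) := by
  have h' := h.toIsEdgeDisjointUnion
  have hmm : m ∈ V(G₁) ∩ V(G₂) := by rw [h.inter_eq]; simp
  rw [← Nat.card_prod]
  refine Nat.card_congr (Equiv.ofBijective (fun σ =>
    (⟨fun x => σ.1.1 ⟨x, h'.left_le.vertexSet_mono x.2⟩,
      ((h'.isProperColoring_iff _).1 σ.1.2.1).1, fun x hx => σ.1.2.2.1 _ hx,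
      fun x hx => (congrArg σ.1.1 (Subtype.ext hx)).trans σ.2⟩,
     ⟨fun x => σ.1.1 ⟨x, h'.right_le.vertexSet_mono x.2⟩,
      ((h'.isProperColoring_iff _).1 σ.1.2.1).2,
      fun x hx => (congrArg σ.1.1 (Subtype.ext hx)).trans σ.2,
      fun x hx => σ.1.2.2.2 _ hx⟩)) ⟨fun σ τ hστ => ?_, ?_⟩)
  · replace hστ := Prod.mk.injEq .. ▸ hστ
    exact Subtype.ext (Subtype.ext (h'.ext_coloring
      (fun x => congrFun (congrArg Subtype.val hστ.1) x)
      (fun x => congrFun (congrArg Subtype.val hστ.2) x)))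
  · rintro ⟨σ₁, σ₂⟩
    obtain ⟨σ, hσ₁, hσ₂⟩ := h'.exists_glue σ₁.1 σ₂.1 fun x h₁ h₂ => by
      have hx : x ∈ V(G₁) ∩ V(G₂) := ⟨h₁, h₂⟩
      rw [h.inter_eq, Set.mem_singleton_iff] at hx
      rw [σ₁.2.2.2 _ hx, σ₂.2.2.1 _ hx]
    have e₁ := funext hσ₁
    have e₂ := funext hσ₂
    refine ⟨⟨⟨σ, (h'.isProperColoring_iff _).2 ⟨?_, ?_⟩, ?_, ?_⟩, ?_⟩, ?_⟩
    · rw [e₁]; exact σ₁.2.1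
    · rw [e₂]; exact σ₂.2.1
    · intro x hx
      rw [← σ₁.2.2.1 ⟨x, hx ▸ hs⟩ hx, ← hσ₁]
    · intro x hx
      rw [← σ₂.2.2.2 ⟨x, hx ▸ ht⟩ hx, ← hσ₂]
    · exact (hσ₁ ⟨m, hmm.1⟩).trans (σ₁.2.2.2 _ rfl)
    · exact Prod.ext (Subtype.ext e₁) (Subtype.ext e₂)

theorem finite_terminalColoring [Finite C] (hV : V(G).Finite) (s t : α) (a b : C) :
    Finite (G.TerminalColoring s t a b) :=
  have := hV.to_subtype
  inferInstanceAs (Finite {_σ : V(G) → C // _})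

theorem IsSeriesComposition.card_terminalColoring [Fintype C]
    (h : G.IsSeriesComposition G₁ G₂ m) (hV : V(G).Finite)
    (hs : s ∈ V(G₁)) (ht : t ∈ V(G₂)) (a b : C) : Nat.card (G.TerminalColoring s t a b) =
      ∑ c, Nat.card (G₁.TerminalColoring s m a c) * Nat.card (G₂.TerminalColoring m t c b) := by
  have := finite_terminalColoring hV s t a b
  have hm : m ∈ V(G) := h.left_le.vertexSet_mono
    (show m ∈ V(G₁) ∩ V(G₂) by rw [h.inter_eq]; simp).1
  simp_rw [← h.card_fiber hs ht hm]
  rw [← Nat.card_sigma]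
  exact Nat.card_congr
    (Equiv.sigmaFiberEquiv fun σ : G.TerminalColoring s t a b => σ.1 ⟨m, hm⟩).symm

theorem card_isProperColoring [Fintype C] (hV : V(G).Finite) (hs : s ∈ V(G)) (ht : t ∈ V(G)) :
    Nat.card {σ : V(G) → C // G.IsProperColoring σ} =
      ∑ p : C × C, Nat.card (G.TerminalColoring s t p.1 p.2) := by
  have := hV.to_subtype
  have := fun p : C × C => finite_terminalColoring hV s t p.1 p.2
  rw [← Nat.card_sigma]
  refine Nat.card_congr ((Equiv.sigmaFiberEquiv fun σ : {σ : V(G) → C // G.IsProperColoring σ} =>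
    (σ.1 ⟨s, hs⟩, σ.1 ⟨t, ht⟩)).symm.trans (Equiv.sigmaCongrRight fun p => ?_))
  exact
    { toFun := fun σ => ⟨σ.1.1, σ.1.2,
        fun x hx => (congrArg σ.1.1 (Subtype.ext hx)).trans (congrArg Prod.fst σ.2),
        fun x hx => (congrArg σ.1.1 (Subtype.ext hx)).trans (congrArg Prod.snd σ.2)⟩
      invFun := fun σ => ⟨⟨σ.1, σ.2.1⟩, Prod.ext (σ.2.2.1 _ rfl) (σ.2.2.2 _ rfl)⟩
      left_inv := fun _ => rfl
      right_inv := fun _ => rfl }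

/-- The polynomials `S` and `D` count the proper colourings of `G` with prescribed colours at the
terminals: `S` if these are the same, `D` if they are different. -/
def CountsColorings (G : Graph α β) (s t : α) (S D : ℤ[X]) : Prop :=
  ∀ (n : ℕ) (a b : Fin n), (Nat.card (G.TerminalColoring s t a b) : ℤ) =
    if a = b then S.eval (n : ℤ) else D.eval (n : ℤ)

variable {S D S₁ D₁ S₂ D₂ : ℤ[X]}

theorem CountsColorings.parallel (h : G.IsParallelComposition G₁ G₂ s t)
    (h₁ : G₁.CountsColorings s t S₁ D₁) (h₂ : G₂.CountsColorings s t S₂ D₂) :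
    G.CountsColorings s t (S₁ * S₂) (D₁ * D₂) := by
  intro n a b
  rw [h.card_terminalColoring, Nat.cast_mul, h₁, h₂]
  split_ifs <;> simp

theorem CountsColorings.series (h : G.IsSeriesComposition G₁ G₂ m) (hV : V(G).Finite)
    (hs : s ∈ V(G₁)) (ht : t ∈ V(G₂))
    (h₁ : G₁.CountsColorings s m S₁ D₁) (h₂ : G₂.CountsColorings m t S₂ D₂) :
    G.CountsColorings s t (S₁ * S₂ + (Polynomial.X - 1) * (D₁ * D₂))
      (S₁ * D₂ + D₁ * S₂ + (Polynomial.X - 2) * (D₁ * D₂)) := by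
  intro n a b
  rw [h.card_terminalColoring hV hs ht, Nat.cast_sum]
  simp_rw [Nat.cast_mul, h₁ n, h₂ n]
  generalize hS₁ : S₁.eval (n : ℤ) = s₁
  generalize hS₂ : S₂.eval (n : ℤ) = s₂
  generalize hD₁ : D₁.eval (n : ℤ) = d₁
  generalize hD₂ : D₂.eval (n : ℤ) = d₂
  -- Expansion of (d₁ + [a = c](s₁ - d₁)) (d₂ + [c = b](s₂ - d₂)), arranged so that each indicator
  -- collapses in the sum over c.
  have key : ∀ c : Fin n, (if a = c then s₁ else d₁) * (if c = b then s₂ else d₂) =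
      d₁ * d₂ + (if a = c then (s₁ - d₁) * d₂ else 0) + (if c = b then d₁ * (s₂ - d₂) else 0) +
        (if a = c then (if a = b then (s₁ - d₁) * (s₂ - d₂) else 0) else 0) := by
    intro c
    by_cases h1 : a = c
    · subst h1
      split_ifs <;> ring
    · simp only [h1, if_false]
      split_ifs <;> ring
  rw [Finset.sum_congr rfl fun c _ => key c]
  simp only [Finset.sum_add_distrib, Finset.sum_ite_eq,
    Finset.sum_ite_eq', Finset.mem_univ, if_true, Finset.sum_const, Finset.card_univ,
    Fintype.card_fin, nsmul_eq_mul, Polynomial.eval_add, Polynomial.eval_mul,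
    Polynomial.eval_sub, Polynomial.eval_X, Polynomial.eval_one, Polynomial.eval_ofNat,
    hS₁, hS₂, hD₁, hD₂]
  split_ifs <;> ring

/-- The chromatic polynomial in terms of the numbers of colourings with prescribed colours at the
terminals. -/
theorem CountsColorings.chromaticPolynomial_eq (h : G.CountsColorings s t S D)
    (hV : V(G).Finite) (hE : E(G).Finite) (hs : s ∈ V(G)) (ht : t ∈ V(G)) :
    G.chromaticPolynomial = Polynomial.X * (S + (Polynomial.X - 1) * D) := by
  -- Both sides count the proper n-colourings at every natural number n, which is enough points for
  -- an identity of polynomials.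
  refine Polynomial.eq_of_infinite_eval_eq _ _
    ((Set.infinite_range_of_injective (Nat.cast_injective (R := ℤ))).mono ?_)
  rintro _ ⟨n, rfl⟩
  rw [Set.mem_ofPred_eq, eval_chromaticPolynomial hV hE, card_isProperColoring hV hs ht,
    Nat.cast_sum, Fintype.sum_prod_type]
  simp_rw [h n]
  have key : ∀ a b : Fin n, (if a = b then S.eval (n : ℤ) else D.eval (n : ℤ)) =
      D.eval (n : ℤ) + if a = b then S.eval (n : ℤ) - D.eval (n : ℤ) else 0 := by
    intro a b
    split_ifs <;> ring
  simp_rw [key]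
  simp only [Finset.sum_add_distrib, Finset.sum_ite_eq, Finset.mem_univ, if_true,
    Finset.sum_const, Finset.card_univ, Fintype.card_fin, nsmul_eq_mul, Polynomial.eval_add,
    Polynomial.eval_mul, Polynomial.eval_sub, Polynomial.eval_X, Polynomial.eval_one]
  ring

theorem IsK2.countsColorings (h : G.IsK2 s t) : G.CountsColorings s t 0 1 := by
  classical
  obtain ⟨hst, e, rfl⟩ := h
  intro n a b
  by_cases hab : a = b
  · rw [if_pos hab, Polynomial.eval_zero, Nat.cast_eq_zero, Nat.card_eq_zero]
    refine .inl ⟨fun σ => σ.2.1 e ⟨s, by simp⟩ ⟨t, by simp⟩ (by simp) ?_⟩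
    rw [σ.2.2.1 _ rfl, σ.2.2.2 _ rfl, hab]
  · rw [if_neg hab, Polynomial.eval_one, Nat.cast_eq_one, Nat.card_eq_one_iff_unique]
    refine ⟨⟨fun σ τ => Subtype.ext (funext fun x => ?_)⟩,
      ⟨⟨fun x => if x.1 = s then a else b, ?_, fun x hx => if_pos hx, fun x hx => ?_⟩⟩⟩
    · rcases (by simpa using x.2 : x.1 = s ∨ x.1 = t) with hx | hx
      · rw [σ.2.2.1 _ hx, τ.2.2.1 _ hx]
      · rw [σ.2.2.2 _ hx, τ.2.2.2 _ hx]
    · intro e' x y hxy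
      obtain ⟨-, ⟨hx, hy⟩ | ⟨hx, hy⟩⟩ := (banana_isLink ..).mp hxy
      · simp only [hx, hy, hst.symm, if_true, if_false]
        exact hab
      · simp only [hx, hy, hst.symm, if_true, if_false]
        exact Ne.symm hab
    · exact if_neg fun h => hst (h.symm.trans hx)

end Graph

/-! ### The Wheatstone bridge and the Wheatstone class -/

namespace Graph

variable {α β C : Type*} {G H : Graph α β} {s t : α}

theorem IsLink.ne_of_ne {e : β} {u v : V(G)} (h : G.IsLink e u v) {σ : V(G) → C}
    (hσ : σ u ≠ σ v) (x y : V(G)) (hxy : G.IsLink e x y) : σ x ≠ σ y := by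
  rcases h.eq_and_eq_or_eq_and_eq hxy with ⟨h1, h2⟩ | ⟨h1, h2⟩
  · rwa [← Subtype.ext h1, ← Subtype.ext h2]
  · rw [← Subtype.ext h1, ← Subtype.ext h2]
    exact hσ.symm

/-- Each inner vertex is adjacent to both terminals and to the other inner vertex, so a colouring is
an ordered pair of distinct colours outside {a, b}. -/
theorem IsWheatstoneBridge.card_terminalColoring [Fintype C] [DecidableEq C]
    (h : G.IsWheatstoneBridge s t) (a b : C) :
    Nat.card (G.TerminalColoring s t a b) = (({a, b} : Finset C)ᶜ).offDiag.card := by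
  classical
  obtain ⟨u, v, e₁, e₂, e₃, e₄, e₅, hV, -, hG, hE, l₁, l₂, l₃, l₄, l₅⟩ := h
  have hs := l₁.left_mem
  have hu := l₁.right_mem
  have hv := l₂.right_mem
  have ht := l₄.right_mem
  simp only [List.nodup_cons, List.mem_cons, List.not_mem_nil, or_false, not_or] at hV
  obtain ⟨⟨hsu, hsv, hst⟩, ⟨huv, hut⟩, hvt, -⟩ := hV
  rw [← Fintype.card_coe, ← Nat.card_eq_fintype_card]
  refine Nat.card_congr (Equiv.ofBijective (fun σ => ⟨(σ.1 ⟨u, hu⟩, σ.1 ⟨v, hv⟩), ?_⟩)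
    ⟨fun σ τ hστ => ?_, ?_⟩)
  · rw [Finset.mem_offDiag, Finset.mem_compl, Finset.mem_compl, Finset.mem_insert,
      Finset.mem_singleton, Finset.mem_insert, Finset.mem_singleton, not_or, not_or]
    have σs := σ.2.2.1 ⟨s, hs⟩ rfl
    have σt := σ.2.2.2 ⟨t, ht⟩ rfl
    exact ⟨⟨fun h => σ.2.1 e₁ ⟨s, hs⟩ ⟨u, hu⟩ l₁ (σs.trans h.symm),
      fun h => σ.2.1 e₄ ⟨u, hu⟩ ⟨t, ht⟩ l₄ (h.trans σt.symm)⟩,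
      ⟨fun h => σ.2.1 e₂ ⟨s, hs⟩ ⟨v, hv⟩ l₂ (σs.trans h.symm),
      fun h => σ.2.1 e₅ ⟨v, hv⟩ ⟨t, ht⟩ l₅ (h.trans σt.symm)⟩,
      σ.2.1 e₃ ⟨u, hu⟩ ⟨v, hv⟩ l₃⟩
  · have hστ' := congrArg Subtype.val hστ
    refine Subtype.ext (funext fun ⟨x, hx⟩ => ?_)
    rcases hG.subset hx with rfl | rfl | rfl | (rfl : x = t)
    · exact (σ.2.2.1 _ rfl).trans (τ.2.2.1 _ rfl).symm
    · exact congrArg Prod.fst hστ'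
    · exact congrArg Prod.snd hστ'
    · exact (σ.2.2.2 _ rfl).trans (τ.2.2.2 _ rfl).symm
  · rintro ⟨⟨c, d⟩, hcd⟩
    rw [Finset.mem_offDiag, Finset.mem_compl, Finset.mem_compl, Finset.mem_insert,
      Finset.mem_singleton, Finset.mem_insert, Finset.mem_singleton, not_or, not_or] at hcd
    obtain ⟨⟨hca, hcb⟩, ⟨hda, hdb⟩, hcd⟩ := hcd
    let σ : V(G) → C := fun x => if x.1 = s then a else if x.1 = u then c else
      if x.1 = v then d else b
    have σs : σ ⟨s, hs⟩ = a := if_pos rfl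
    have σu : σ ⟨u, hu⟩ = c := by simp [σ, Ne.symm hsu]
    have σv : σ ⟨v, hv⟩ = d := by simp [σ, Ne.symm hsv, Ne.symm huv]
    have σt : σ ⟨t, ht⟩ = b := by simp [σ, Ne.symm hst, Ne.symm hut, Ne.symm hvt]
    refine ⟨⟨σ, fun e x y hxy => ?_, fun x hx => ?_, fun x hx => ?_⟩, ?_⟩
    · rcases hE.subset hxy.edge_mem with rfl | rfl | rfl | rfl | (rfl : e = e₅)
      · exact IsLink.ne_of_ne (u := ⟨s, hs⟩) (v := ⟨u, hu⟩) l₁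
          (by rw [σs, σu]; exact Ne.symm hca) x y hxy
      · exact IsLink.ne_of_ne (u := ⟨s, hs⟩) (v := ⟨v, hv⟩) l₂
          (by rw [σs, σv]; exact Ne.symm hda) x y hxy
      · exact IsLink.ne_of_ne (u := ⟨u, hu⟩) (v := ⟨v, hv⟩) l₃ (by rwa [σu, σv]) x y hxy
      · exact IsLink.ne_of_ne (u := ⟨u, hu⟩) (v := ⟨t, ht⟩) l₄ (by rwa [σu, σt]) x y hxy
      · exact IsLink.ne_of_ne (u := ⟨v, hv⟩) (v := ⟨t, ht⟩) l₅ (by rwa [σv, σt]) x y hxy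
    · exact (congrArg σ (Subtype.ext hx)).trans σs
    · exact (congrArg σ (Subtype.ext hx)).trans σt
    · exact Subtype.ext (Prod.ext σu σv)

theorem IsWheatstoneBridge.countsColorings (h : G.IsWheatstoneBridge s t) :
    G.CountsColorings s t ((Polynomial.X - 1) * (Polynomial.X - 2))
      ((Polynomial.X - 2) * (Polynomial.X - 3)) := by
  intro n a b
  rw [h.card_terminalColoring, Finset.offDiag_card, Nat.cast_sub (Nat.le_mul_self _)]
  have hc := Finset.card_add_card_compl ({a, b} : Finset (Fin n))
  rw [Fintype.card_fin] at hc
  generalize (({a, b} : Finset (Fin n))ᶜ).card = c at hc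
  split_ifs with hab
  · rw [hab, Finset.pair_eq_singleton, Finset.card_singleton] at hc
    simp only [← hc, Polynomial.eval_mul, Polynomial.eval_sub, Polynomial.eval_X,
      Polynomial.eval_one, Polynomial.eval_ofNat]
    push_cast
    ring
  · rw [Finset.card_pair hab] at hc
    simp only [← hc, Polynomial.eval_mul, Polynomial.eval_sub, Polynomial.eval_X,
      Polynomial.eval_ofNat]
    push_cast
    ring

theorem IsWheatstoneBridge.hasDisjointWalks (h : G.IsWheatstoneBridge s t) :
    G.HasDisjointWalks s t 2 := by
  obtain ⟨u, v, e₁, e₂, e₃, e₄, e₅, -, hE, -, -, l₁, l₂, -, l₄, l₅⟩ := h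
  have hd : List.Disjoint [e₁, e₄] [e₂, e₅] := by
    simp only [List.nodup_cons, List.mem_cons, List.not_mem_nil, or_false, not_or] at hE
    simp only [List.disjoint_cons_left, List.disjoint_nil_left, List.mem_cons, List.not_mem_nil, or_false, not_or]
    grind
  refine ⟨![[e₁, e₄], [e₂, e₅]], fun i => ?_, fun i j => ?_⟩
  · fin_cases i
    · exact l₁.isWalkEdges.append l₄.isWalkEdges
    · exact l₂.isWalkEdges.append l₅.isWalkEdges
  · fin_cases i <;> fin_cases j
    · exact fun h => absurd rfl h
    · exact fun _ => hd
    · exact fun _ => hd.symm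
    · exact fun h => absurd rfl h

/-- The terminals of a member of the class are distinct vertices, and it is finite. -/
theorem InWheatstoneClass.basic (h : G.InWheatstoneClass s t) :
    V(G).Finite ∧ E(G).Finite ∧ s ∈ V(G) ∧ t ∈ V(G) ∧ s ≠ t := by
  induction h with
  | k2 G s t h =>
    obtain ⟨hst, e, rfl⟩ := h
    exact ⟨Set.toFinite {s, t}, Set.toFinite {e}, Set.mem_insert .., Set.mem_insert_of_mem _ rfl,
      hst⟩
  | bridge G s t h =>
    obtain ⟨u, v, e₁, e₂, e₃, e₄, e₅, hV, -, hG, hE, l₁, -, -, l₄, -⟩ := h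
    refine ⟨hG ▸ Set.toFinite _, hE ▸ Set.toFinite _, l₁.left_mem, l₄.right_mem, ?_⟩
    rintro rfl
    simp at hV
  | parallel G G₁ G₂ s t _ _ h ih₁ ih₂ =>
    have h' := h.toIsEdgeDisjointUnion
    refine ⟨h.vertexSet_eq ▸ ih₁.1.union ih₂.1, h'.edgeSet_eq ▸ ih₁.2.1.union ih₂.2.1,
      h'.left_le.vertexSet_mono ih₁.2.2.1, h'.left_le.vertexSet_mono ih₁.2.2.2.1, ih₁.2.2.2.2⟩
  | series G G₁ G₂ s m t _ _ h ih₁ ih₂ =>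
    have h' := h.toIsEdgeDisjointUnion
    refine ⟨h.vertexSet_eq ▸ ih₁.1.union ih₂.1, h'.edgeSet_eq ▸ ih₁.2.1.union ih₂.2.1,
      h'.left_le.vertexSet_mono ih₁.2.2.1, h'.right_le.vertexSet_mono ih₂.2.2.2.1, ?_⟩
    rintro rfl
    have hs : s ∈ V(G₁) ∩ V(G₂) := ⟨ih₁.2.2.1, ih₂.2.2.2.1⟩
    rw [h.inter_eq] at hs
    exact ih₁.2.2.2.2 hs

open Transmissivity in
/-- A 2-terminal graph of the class has its transmissivity in the region for its flow if it can be
completed by a detour to a graph of maxmaxflow at most `Λ`. -/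
theorem InWheatstoneClass.exists_inRegion {Λ : ℕ} {q : ℂ} {y : ℝ}
    (hg : IsGrowth ‖q - 1‖ y) (hy : ∀ k, k + 1 ≤ Λ → y ^ k * (1 + ‖q - 1‖) ≤ 2 * ‖q - 1‖)
    (h : G.InWheatstoneClass s t) : ∃ (k : ℕ) (S D : ℤ[X]), 1 ≤ k ∧ G.HasDisjointWalks s t k ∧
      G.CountsColorings s t S D ∧
      (∀ H : Graph α β, G ≤ H → H.maxmaxflow ≤ Λ → G.HasDetour H s t →
        InRegion q y k (Polynomial.aeval q S) (Polynomial.aeval q D)) ∧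
      (G.maxmaxflow ≤ Λ → Polynomial.aeval q S + (q - 1) * Polynomial.aeval q D ≠ 0) := by
  have hQ := hg.one_lt
  -- The ambient graph H varies in the hypothesis because the detour of a piece may leave the
  -- composition. Nonvanishing is a separate clause because the whole graph need not have a detour.
  induction h with
  | k2 G s t h =>
    have hr : InRegion q y 1 (Polynomial.aeval q (0 : ℤ[X])) (Polynomial.aeval q (1 : ℤ[X])) := by
      rw [map_zero, map_one]
      exact inRegion_edge hQ
    have hc := h.countsColorings
    obtain ⟨-, e, rfl⟩ := h
    refine ⟨1, 0, 1, le_rfl, .one (IsLink.isWalkEdges (e := e) ?_), hc, fun _ _ _ _ => hr,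
      fun _ => hr.1⟩
    simp
  | bridge G s t h =>
    have hr := inRegion_bridge hg
    refine ⟨2, _, _, one_le_two, h.hasDisjointWalks, h.countsColorings, fun _ _ _ _ => ?_,
      fun _ => ?_⟩
    · simpa [map_ofNat] using hr
    · simpa [map_ofNat] using hr.1
  | parallel G G₁ G₂ s t g₁ g₂ h ih₁ ih₂ =>
    obtain ⟨k₁, S₁, D₁, hk₁, w₁, c₁, r₁, -⟩ := ih₁
    obtain ⟨k₂, S₂, D₂, hk₂, w₂, c₂, r₂, -⟩ := ih₂
    have h' := h.toIsEdgeDisjointUnion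
    obtain ⟨-, -, hs₁, ht₁, hst⟩ := g₁.basic
    obtain ⟨-, -, hs₂, ht₂, -⟩ := g₂.basic
    have hr : ∀ H : Graph α β, G ≤ H → H.maxmaxflow ≤ Λ → G₁.HasDetour H s t →
        G₂.HasDetour H s t → InRegion q y (k₁ + k₂) (Polynomial.aeval q (S₁ * S₂))
          (Polynomial.aeval q (D₁ * D₂)) := by
      intro H hGH hH d₁ d₂
      rw [map_mul, map_mul]
      have l₁ := h'.left_le.trans hGH
      have l₂ := h'.right_le.trans hGH
      exact InRegion.parallel hQ
        (hy _ (by exact_mod_cast w₁.succ_le l₁ d₁ hs₁ ht₁ hst hH))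
        (hy _ (by exact_mod_cast w₂.succ_le l₂ d₂ hs₂ ht₂ hst hH)) (by linarith [hg.one_le])
        (r₁ H l₁ hH d₁) (r₂ H l₂ hH d₂)
    refine ⟨k₁ + k₂, S₁ * S₂, D₁ * D₂, by omega,
      w₁.add h'.left_le h'.right_le h.disjoint_edgeSet w₂, c₁.parallel h c₂,
      fun H hGH hH d => hr H hGH hH (d.anti_left h'.left_le) (d.anti_left h'.right_le),
      fun hG => ?_⟩
    obtain ⟨es₁, v₁⟩ := w₁.exists_isWalkEdges hk₁
    obtain ⟨es₂, v₂⟩ := w₂.exists_isWalkEdges hk₂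
    -- Without an outer detour k₁ + k₂ may exceed Λ - 1, but each half is a detour for the other,
    -- and only T ≠ 0 is taken from the region.
    exact (hr G le_rfl hG (v₂.hasDetour h'.right_le h.disjoint_edgeSet)
      (v₁.hasDetour h'.left_le h.disjoint_edgeSet.symm)).1
  | series G G₁ G₂ s m t g₁ g₂ h ih₁ ih₂ =>
    have hV := (InWheatstoneClass.series G G₁ G₂ s m t g₁ g₂ h).basic.1
    obtain ⟨k₁, S₁, D₁, hk₁, w₁, c₁, r₁, n₁⟩ := ih₁
    obtain ⟨k₂, S₂, D₂, hk₂, w₂, c₂, r₂, n₂⟩ := ih₂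
    have h' := h.toIsEdgeDisjointUnion
    obtain ⟨-, -, hs₁, ht₁, hst₁⟩ := g₁.basic
    obtain ⟨-, -, hs₂, ht₂, hst₂⟩ := g₂.basic
    refine ⟨min k₁ k₂, _, _, le_min hk₁ hk₂, (w₁.mono_right (min_le_left _ _)).append h'.left_le
      h'.right_le h.disjoint_edgeSet (w₂.mono_right (min_le_right _ _)),
      c₁.series h hV hs₁ ht₂ c₂, fun H hGH hH d => ?_, fun hG => ?_⟩
    · have l₁ := h'.left_le.trans hGH
      have l₂ := h'.right_le.trans hGH
      obtain ⟨es₁, v₁⟩ := w₁.exists_isWalkEdges hk₁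
      obtain ⟨es₂, v₂⟩ := w₂.exists_isWalkEdges hk₂
      -- From s go around G to t, then back through G₂ to m.
      have d₁ : G₁.HasDetour H s m := (d.anti_left h'.left_le).trans
        (v₂.hasDetour l₂ h.disjoint_edgeSet).symm
      have d₂ : G₂.HasDetour H m t := (v₁.hasDetour l₁ h.disjoint_edgeSet.symm).symm.trans
        (d.anti_left h'.right_le)
      have := InRegion.series hg
        (hy _ (by exact_mod_cast w₁.succ_le l₁ d₁ hs₁ ht₁ hst₁ hH))
        (hy _ (by exact_mod_cast w₂.succ_le l₂ d₂ hs₂ ht₂ hst₂ hH))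
        (r₁ H l₁ hH d₁) (r₂ H l₂ hH d₂)
      -- A series composition lies in the region of exponent 1, which is at most `min k₁ k₂`.
      simpa [map_ofNat] using this.mono hg.one_le (le_min hk₁ hk₂)
    -- With no detour available the regions of the halves are unknown, but T is multiplicative in
    -- series, so nonvanishing alone suffices.
    · have := mul_ne_zero (n₁ ((maxmaxflow_mono h'.left_le).trans hG))
        (n₂ ((maxmaxflow_mono h'.right_le).trans hG))
      rw [← series_total] at this
      simpa [map_ofNat] using this

open Transmissivity in
theorem InWheatstoneClass.aeval_chromaticPolynomial_ne_zero {Λ : ℕ} (hΛ : 1 ≤ Λ)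
    (h : G.InWheatstoneClass s t) (hG : G.maxmaxflow ≤ Λ) {q : ℂ} (hQ : 1 < ‖q - 1‖)
    (hq : (1 + 1 / ‖q - 1‖) ^ (Λ + 1) ≤
      4 * (1 - 1 / ‖q - 1‖ + 2 * (1 / ‖q - 1‖) ^ 2) ^ (Λ - 1)) :
    Polynomial.aeval q G.chromaticPolynomial ≠ 0 := by
  obtain ⟨y, hg, hy⟩ := exists_isGrowth hΛ hQ hq
  obtain ⟨hV, hE, hs, ht, -⟩ := h.basic
  obtain ⟨k, S, D, -, -, hc, -, hn⟩ := h.exists_inRegion hg hy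
  rw [hc.chromaticPolynomial_eq hV hE hs ht]
  have hq0 : q ≠ 0 := by
    rintro rfl
    simp at hQ
  simpa using mul_ne_zero hq0 (hn hG)

end Graph

theorem corollary8p4 {α β : Type*} (Λ : ℕ) (hΛ : 3 ≤ Λ) :
    ∃ ρ : ℝ,
      (ρ ∈ Set.Ioo (0 : ℝ) 1 ∧
        (1 + ρ) ^ (Λ + 1) = 4 * (1 - ρ + 2 * ρ ^ 2) ^ (Λ - 1)) ∧
      (∀ ρ' ∈ Set.Ioo (0 : ℝ) 1,
        (1 + ρ') ^ (Λ + 1) = 4 * (1 - ρ' + 2 * ρ' ^ 2) ^ (Λ - 1) → ρ' = ρ) ∧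
      ∀ (G : Graph α β) (s t : α), G.InWheatstoneClass s t → G.maxmaxflow ≤ (Λ : ℕ∞) →
        ∀ q : ℂ, 1 / ρ ≤ ‖q - 1‖ → Polynomial.aeval q G.chromaticPolynomial ≠ 0 := by
  obtain ⟨ρ, hρ, heq, huniq, hle⟩ := WheatstoneRadius.exists_radius hΛ
  refine ⟨ρ, ⟨hρ, heq⟩, huniq, fun G s t h hG q hq => ?_⟩
  have hQ : 1 < ‖q - 1‖ := ((one_lt_div hρ.1).2 hρ.2).trans_le hq
  refine h.aeval_chromaticPolynomial_ne_zero (by omega) hG hQ (hle _ (by positivity) ?_)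
  exact (one_div_le hρ.1 (by linarith)).1 hq
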